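/- Fix an integer $k\ge 2$. Consider the stochastic $k$-armed bandit over $T$ rounds. An environment is a tuple of reward distributions $(\mathcal D_1,\dots,\mathcal D_k)$ on $\mathbb R$ with means $\mu_1,\dots,\mu_k$ that are standardized sub-Gaussian, i.e. $\mathbb E_{X\sim\mathcal D_i}[e^{s(X-\mu_i)}]\le e^{s^2/2}$ for all $s\in\mathbb R$, and satisfy $|\mu_i-\mu_j|\le 1$ for all $i,j$. In every round a policy chooses, possibly at random, an arm on the basis of the arms chosen and rewards observed before, and then observes a reward drawn from the distribution of the chosen arm. A policy (which may depend on $T$) is an $S$-switch policy if, in every environment, almost surely at most $S$ of the indices $t\in\{1,\dots,T-1\}$ satisfy $\pi_t\ne\pi_{t+1}$, where $\pi_t$ is the arm chosen in round $t$. Its regret is $R^{\pi}(T)=\sup_{\mathcal D}\{T\max_i\mu_i-\mathbb E^{\pi}_{\mathcal D}[\sum_{t=1}^T\mu_{\pi_t}]\}$. We write $f(T)=\tilde O(g(T))$ if there are constants $C$ and $p$ with $f(T)\le C(\log T)^p g(T)$ for all sufficiently large $T$; for a family of policies (one for each $T$) these constants may depend on $k$ and on the family. 1. Let $N\ge 1$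 be a fixed integer. There is a family of policies $(\pi^{(T)})_T$ such that $\pi^{(T)}$ is an $(N(k-1)+1)$-switch policy for every $T$ and $R^{\pi^{(T)}}(T)=\tilde O\big(T^{1/(2-2^{-N})}\big)$. Conversely, if a family of policies satisfies $R^{\pi^{(T)}}(T)=\tilde O\big(T^{1/(2-2^{-N})}\big)$, then for all sufficiently large $T$ the policy $\pi^{(T)}$ is an $S$-switch policy only if $S\ge N(k-1)+1$ (that is, in some environment it makes at least $N(k-1)+1$ switches with positive probability). 2. There are budgets $S(T)=\Theta(\log\log T)$ and a family of policies $(\pi^{(T)})_T$ such that $\pi^{(T)}$ is an $S(T)$-switch policy for every $T$ and $R^{\pi^{(T)}}(T)=\tilde O(\sqrt T)$. Conversely, there is a constant $c>0$, which depends on $k$ only, such that, if a family of policies satisfies $R^{\pi^{(T)}}(T)=\tilde O(\sqrt T)$, then for all sufficiently large $T$ the policy $\pi^{(T)}$ is an $S$-switch policy only if $S\ge c\log\log T$. -/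

import Mathlib

open MeasureTheory ProbabilityTheory Filter

noncomputable section

namespace Bandit

/-- A latent environment of the stochastic `k`-armed bandit: arm `i` has reward distribution
`dist i`, which is standardized sub-Gaussian, that is
`E[exp (s (X - E X))] ≤ exp (s ^ 2 / 2)` for every real `s`
(finiteness of all these exponential moments is part of `HasSubgaussianMGF`, so the mean exists),
and the means of any two arms differ by at most `1`. -/
structure Environment (k : ℕ) where
  dist : Fin k → Measure ℝ
  isProbabilityMeasure : ∀ i, IsProbabilityMeasure (dist i)
  subgaussian : ∀ i, HasSubgaussianMGF (fun x => x - ∫ y, y ∂(dist i)) 1 (dist i)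
  gap_le_one : ∀ i j, |(∫ y, y ∂(dist i)) - ∫ y, y ∂(dist j)| ≤ 1

/-- The mean reward of arm `i`. -/
def Environment.mean {k : ℕ} (D : Environment k) (i : Fin k) : ℝ := ∫ y, y ∂(D.dist i)

/-- The largest mean reward. -/
def Environment.bestMean {k : ℕ} (D : Environment k) : ℝ := ⨆ i, D.mean i

/-- The reward distributions as a kernel from arms to rewards. -/
def Environment.rewardKernel {k : ℕ} (D : Environment k) : Kernel (Fin k) ℝ :=
  ⟨D.dist, Measurable.of_discrete⟩

instance {k : ℕ} (D : Environment k) : IsMarkovKernel D.rewardKernel :=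
  ⟨D.isProbabilityMeasure⟩

/-- A history of `t` rounds: the arms chosen and the rewards observed. -/
abbrev History (k t : ℕ) : Type := Fin t → Fin k × ℝ

/-- A (randomized, non-anticipating) policy: the arm of the round that follows `t` completed rounds
is drawn from a probability kernel applied to the history of those `t` rounds. -/
structure Policy (k : ℕ) where
  kernel : (t : ℕ) → Kernel (History k t) (Fin k)
  isMarkovKernel : ∀ t, IsMarkovKernel (kernel t)

instance {k : ℕ} (π : Policy k) (t : ℕ) : IsMarkovKernel (π.kernel t) := π.isMarkovKernel t

/-- Append one round, an arm and its reward, to a history. -/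
def History.append {k t : ℕ} (p : History k t × (Fin k × ℝ)) : History k (t + 1) :=
  Fin.snoc (α := fun _ => Fin k × ℝ) p.1 p.2

theorem History.measurable_append {k t : ℕ} :
    Measurable (History.append : History k t × (Fin k × ℝ) → History k (t + 1)) := by
  refine measurable_pi_lambda _ fun i => ?_
  refine Fin.lastCases ?_ (fun j => ?_) i
  · simpa [History.append] using measurable_snd
  · simp only [History.append, Fin.snoc_castSucc]
    exact (measurable_pi_apply j).comp measurable_fst

/-- The law of the history of the first `T` rounds when policy `π` is run in environment `D`:
given the past, the next arm is drawn from the policy, and then, given the past and that arm,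
the reward is drawn from the distribution of that arm. -/
def law {k : ℕ} (π : Policy k) (D : Environment k) : (T : ℕ) → Measure (History k T)
  | 0 => Measure.dirac Fin.elim0
  | T + 1 =>
      ((law π D T) ⊗ₘ (π.kernel T ⊗ₖ Kernel.prodMkLeft (History k T) D.rewardKernel)).map
        History.append

instance {k : ℕ} (π : Policy k) (D : Environment k) (T : ℕ) :
    IsProbabilityMeasure (law π D T) := by
  induction T with
  | zero => unfold law; infer_instance
  | succ T ih =>
    unfold law
    exact Measure.isProbabilityMeasure_map History.measurable_append.aemeasurable

/-- The number of switches in a history: the number of pairs of consecutive rounds in which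
different arms are chosen. -/
def numSwitches {k T : ℕ} (h : History k T) : ℕ :=
  (Finset.univ.filter fun p : Fin T × Fin T =>
    (p.1 : ℕ) + 1 = (p.2 : ℕ) ∧ (h p.1).1 ≠ (h p.2).1).card

/-- `π` is an `S`-switch policy over the horizon `T`: in every environment it makes, almost surely,
at most `S` switches during the first `T` rounds. -/
def IsSwitchPolicy {k : ℕ} (S T : ℕ) (π : Policy k) : Prop :=
  ∀ D : Environment k, ∀ᵐ h ∂(law π D T), numSwitches h ≤ S

/-- The regret of `π` over the horizon `T` in the environment `D`. -/
def envRegret {k : ℕ} (π : Policy k) (T : ℕ) (D : Environment k) : ℝ :=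
  T * D.bestMean - ∫ h, ∑ t : Fin T, D.mean (h t).1 ∂(law π D T)

/-- The (distribution-free) regret of `π` over the horizon `T`: the supremum, taken in the extended
reals, of its regret over all environments. -/
def regret {k : ℕ} (π : Policy k) (T : ℕ) : EReal :=
  ⨆ D : Environment k, (envRegret π T D : EReal)

/-- `f = Õ(g)` as `T → ∞`: an upper bound up to a constant and a power of `log T`. -/
def IsSoftO (f : ℕ → EReal) (g : ℕ → ℝ) : Prop :=
  ∃ (C : ℝ) (p : ℕ), ∀ᶠ T : ℕ in atTop, f T ≤ ((C * Real.log T ^ p * g T : ℝ) : EReal)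

end Bandit

end

/-! Lower bounds. Take a policy with at most `(M + 1) * (k - 1)` switches and a grid `t 0 ≤ ... ≤ t
(M + 1) ≤ T`, and run it with all arms standard Gaussian. Seeing all `k` arms within one grid
interval costs `k - 1` switches. So either some arm is skipped during some interval, or the budget
is exhausted when the last missing arm of the last interval is first played, and the policy is stuck
with that arm (`exists_avoided_or_exists_first`). By pigeonhole one of these `(M + 2) * k` events
has probability at least `1 / ((M + 2) * k)`. If arm `i` is skipped from `t j` to `t (j + 1)`, raise
its mean by about `1 / √(t j)`; if the policy commits to `i`, lower its mean by about `1 / √(t M)`.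
Arm `i` has been played too rarely for the policy to notice (`sq_mul_exp_le_measureReal_shiftEnv`),
and it pays the gap during the skipped interval, respectively from `t (M + 1)` to `T`. Balancing
these losses gives regret of order `T ^ (1 / (2 - 2 ^ (-M)))`, with explicit dependence on `M`
(`exists_rpow_le_envRegret`). With `M = N - 1` the exponent exceeds the permitted one. If `S < (1 /
2) * log log T`, then `M = S` yields a factor `exp (√(log T) / 4)` over `√T`, up to powers of `log
T`.

Upper bounds. Successive elimination on a fixed schedule: epoch `l` gives each arm a slot of `n l`
rounds, and the slots of eliminated arms are filled by surviving ones. The order of the arms is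
reversed from epoch to epoch, so that a boundary costs no switch beyond the `k - 1` of an epoch; the
slots of epoch `N` are so long that only its first is ever entered, at the price of one more switch
(`FollowsSchedule.switches_le`). Survivors of epoch `l` have gaps of order `√(log T / n l)`, so
epoch `l + 1` costs about `n (l + 1) / √(n l)`; the choice `n l ≈ R ^ (2 - 2 ^ (-l))`, with `n N ≈
T`, makes each such cost about `R = T ^ (1 / (2 - 2 ^ (-N)))` (`envRegret_batchPolicy_le`). This
bound is uniform in `N`, so `N` of order `log log T` is allowed and brings `R` down to order `√T`.
-/

namespace Bandit

open scoped ENNReal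

variable {k : ℕ}

/-! ### Laws of histories, restriction to earlier rounds, regret as an expected sum of gaps. -/

section Law

instance (D : Environment k) (i : Fin k) : IsProbabilityMeasure (D.dist i) :=
  D.isProbabilityMeasure i

theorem Environment.rewardKernel_apply (D : Environment k) (i : Fin k) :
    D.rewardKernel i = D.dist i := rfl

theorem History.append_castSucc {t : ℕ} (h : History k t) (z : Fin k × ℝ) (u : Fin t) :
    History.append (h, z) u.castSucc = h u := by
  simp [History.append]

theorem History.append_last {t : ℕ} (h : History k t) (z : Fin k × ℝ) :
    History.append (h, z) (Fin.last t) = z := by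
  simp [History.append]

theorem lintegral_law_succ (π : Policy k) (D : Environment k) (T : ℕ)
    {g : History k (T + 1) → ℝ≥0∞} (hg : Measurable g) :
    ∫⁻ h, g h ∂(law π D (T + 1)) =
      ∫⁻ h, ∫⁻ a, ∫⁻ x, g (History.append (h, (a, x))) ∂(D.dist a) ∂(π.kernel T h)
        ∂(law π D T) := by
  have hg' : Measurable fun p : History k T × (Fin k × ℝ) => g (History.append p) :=
    hg.comp History.measurable_append
  rw [law, lintegral_map hg History.measurable_append, Measure.lintegral_compProd hg']
  refine lintegral_congr fun h => ?_
  rw [Kernel.lintegral_compProd _ _ _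
    (show Measurable fun z => g (History.append (h, z)) from hg'.comp measurable_prodMk_left)]
  simp [Kernel.prodMkLeft_apply, Environment.rewardKernel_apply]

/-- The history of the first `m` of `T` rounds. -/
def History.take {T : ℕ} (m : ℕ) (hm : m ≤ T) (h : History k T) : History k m :=
  fun u => h (Fin.castLE hm u)

theorem History.measurable_take {T m : ℕ} (hm : m ≤ T) :
    Measurable (History.take (k := k) m hm) :=
  measurable_pi_lambda _ fun _ => measurable_pi_apply _

/-- The kernels are Markov, so integrating out the later rounds has no effect on the first `m`. -/
theorem law_map_take (π : Policy k) (D : Environment k) {T m : ℕ} (hm : m ≤ T) :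
    (law π D T).map (History.take m hm) = law π D m := by
  induction T, hm using Nat.le_induction with
  | base =>
    have : (History.take m le_rfl : History k m → History k m) = id := by
      funext h u
      simp [History.take]
    rw [this, Measure.map_id]
  | succ T hmT ih =>
    rw [← ih]
    refine Measure.ext_of_lintegral _ fun f hf => ?_
    rw [lintegral_map hf (History.measurable_take _), lintegral_map hf (History.measurable_take _),
      lintegral_law_succ _ _ _ (show Measurable fun h => f (History.take m _ h) from
        hf.comp (History.measurable_take (hmT.trans (Nat.le_succ T))))]
    refine lintegral_congr fun h => ?_
    have : ∀ z, History.take m (hmT.trans (Nat.le_succ T)) (History.append (h, z)) =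
        History.take m hmT h := by
      intro z
      funext u
      have : Fin.castLE (hmT.trans (Nat.le_succ T)) u = (Fin.castLE hmT u).castSucc := rfl
      simp only [History.take, this, History.append_castSucc]
    simp [this]

theorem law_real_take (π : Policy k) (D : Environment k) {T m : ℕ} (hm : m ≤ T)
    {s : Set (History k m)} (hs : MeasurableSet s) :
    (law π D T).real (History.take m hm ⁻¹' s) = (law π D m).real s := by
  rw [← law_map_take π D hm, map_measureReal_apply (History.measurable_take hm) hs]

theorem Environment.mean_le_bestMean (D : Environment k) (i : Fin k) : D.mean i ≤ D.bestMean :=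
  le_ciSup (Set.finite_range D.mean).bddAbove i

theorem measurable_arm {T : ℕ} (t : Fin T) : Measurable fun h : History k T => (h t).1 :=
  measurable_fst.comp (measurable_pi_apply t)

theorem measurable_reward {T : ℕ} (t : Fin T) : Measurable fun h : History k T => (h t).2 :=
  measurable_snd.comp (measurable_pi_apply t)

theorem measurable_arm_fun {T : ℕ} {α : Type*} [MeasurableSpace α] (f : Fin k → α) (t : Fin T) :
    Measurable fun h : History k T => f (h t).1 :=
  (Measurable.of_discrete (f := f)).comp (measurable_arm t)

theorem integrable_arm_fun (π : Policy k) (D : Environment k) {T : ℕ} (f : Fin k → ℝ)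
    (t : Fin T) : Integrable (fun h : History k T => f (h t).1) (law π D T) := by
  refine Integrable.of_bound (measurable_arm_fun f t).aestronglyMeasurable (∑ i, ‖f i‖) ?_
  exact ae_of_all _ fun h =>
    Finset.single_le_sum (f := fun i => ‖f i‖) (fun i _ => norm_nonneg _) (Finset.mem_univ _)

theorem envRegret_eq_integral_gap (π : Policy k) (T : ℕ) (D : Environment k) :
    envRegret π T D = ∫ h, ∑ t : Fin T, (D.bestMean - D.mean (h t).1) ∂(law π D T) := by
  simp only [Finset.sum_sub_distrib]
  rw [integral_sub (integrable_const _)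
    (integrable_finsetSum _ fun t _ => integrable_arm_fun π D D.mean t)]
  simp [envRegret]

theorem integrable_gap (π : Policy k) (D : Environment k) (T : ℕ) :
    Integrable (fun h : History k T => ∑ t : Fin T, (D.bestMean - D.mean (h t).1))
      (law π D T) :=
  integrable_finsetSum _ fun t _ => integrable_arm_fun π D (fun a => D.bestMean - D.mean a) t

/-- All gaps are nonnegative, so the part of the regret outside `U` may be dropped. -/
theorem mul_measureReal_le_envRegret (π : Policy k) (T : ℕ) (D : Environment k)
    {U : Set (History k T)} (hU : MeasurableSet U) {c : ℝ}
    (h : ∀ᵐ h ∂(law π D T), h ∈ U → c ≤ ∑ t : Fin T, (D.bestMean - D.mean (h t).1)) :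
    c * (law π D T).real U ≤ envRegret π T D := by
  have h1 : ∫ h, U.indicator (fun _ => c) h ∂(law π D T) = c * (law π D T).real U := by
    rw [integral_indicator_const _ hU, smul_eq_mul, mul_comm]
  rw [envRegret_eq_integral_gap, ← h1]
  refine integral_mono_ae ((integrable_const c).indicator hU) (integrable_gap π D T) ?_
  filter_upwards [h] with w hw
  by_cases hwU : w ∈ U
  · simpa [hwU] using hw hwU
  · rw [Set.indicator_of_notMem hwU]
    exact Finset.sum_nonneg fun t _ => sub_nonneg.2 (D.mean_le_bestMean (w t).1)

end Law

/-! ### Gaussian environments and change of measure. -/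

section Gaussian

/-- The environment whose arms have Gaussian rewards with unit variance and means `m`. -/
noncomputable def gaussianEnv (m : Fin k → ℝ) (hm : ∀ i j, |m i - m j| ≤ 1) : Environment k where
  dist i := gaussianReal (m i) 1
  isProbabilityMeasure i := inferInstance
  subgaussian i := by
    have hmap : (gaussianReal (m i) 1).map (fun x => x - ∫ y, y ∂(gaussianReal (m i) 1)) =
        gaussianReal 0 1 := by
      rw [integral_id_gaussianReal, gaussianReal_map_sub_const, sub_self]
    have hmeas : AEMeasurable (fun x : ℝ => x - ∫ y, y ∂(gaussianReal (m i) 1))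
        (gaussianReal (m i) 1) := (measurable_id.sub_const _).aemeasurable
    refine ⟨fun t => ?_, fun t => ?_⟩
    · have h : Integrable (fun x => Real.exp (t * x)) (gaussianReal 0 1) :=
        integrable_exp_mul_gaussianReal t
      rw [← hmap] at h
      exact h.comp_aemeasurable hmeas
    · rw [mgf_gaussianReal hmap]
      simp
  gap_le_one i j := by
    rw [integral_id_gaussianReal, integral_id_gaussianReal]
    exact hm i j

theorem gaussianEnv_mean (m : Fin k → ℝ) (hm : ∀ i j, |m i - m j| ≤ 1) (i : Fin k) :
    (gaussianEnv m hm).mean i = m i :=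
  integral_id_gaussianReal

/-- The Gaussian environment in which all arms have mean zero. -/
noncomputable def baseEnv (k : ℕ) : Environment k := gaussianEnv 0 (by simp)

theorem lintegral_gaussianReal_eq (μ : ℝ) {f : ℝ → ℝ≥0∞} (hf : Measurable f) :
    ∫⁻ x, f x ∂(gaussianReal μ 1) =
      ∫⁻ x, f x * ENNReal.ofReal (Real.exp (μ * x - μ ^ 2 / 2)) ∂(gaussianReal 0 1) := by
  have h1 : (1 : NNReal) ≠ 0 := one_ne_zero
  rw [gaussianReal_of_var_ne_zero _ h1, gaussianReal_of_var_ne_zero _ h1,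
    lintegral_withDensity_eq_lintegral_mul _ (measurable_gaussianPDF _ _) hf,
    lintegral_withDensity_eq_lintegral_mul _ (measurable_gaussianPDF _ _)
      (show Measurable fun x => f x * ENNReal.ofReal (Real.exp (μ * x - μ ^ 2 / 2)) from
        hf.mul (by fun_prop))]
  refine lintegral_congr fun x => ?_
  have : gaussianPDF μ 1 x =
      gaussianPDF 0 1 x * ENNReal.ofReal (Real.exp (μ * x - μ ^ 2 / 2)) := by
    rw [gaussianPDF, gaussianPDF, ← ENNReal.ofReal_mul (gaussianPDFReal_nonneg _ _ _)]
    congr 1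
    simp only [gaussianPDFReal, mul_assoc, ← Real.exp_add]
    congr 3
    simp
    ring
  simp only [Pi.mul_apply, this]
  ring

/-- The logarithm of the likelihood ratio between the Gaussian environment with means `m` and the
one with means zero. -/
noncomputable def logLik (m : Fin k → ℝ) {T : ℕ} (h : History k T) : ℝ :=
  ∑ u, (m (h u).1 * (h u).2 - m (h u).1 ^ 2 / 2)

theorem measurable_logLik (m : Fin k → ℝ) {T : ℕ} :
    Measurable (logLik m : History k T → ℝ) :=
  Finset.measurable_fun_sum _ fun u _ =>
    ((measurable_arm_fun m u).mul (measurable_reward u)).sub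
      (measurable_arm_fun (fun a => m a ^ 2 / 2) u)

theorem logLik_append (m : Fin k → ℝ) {T : ℕ} (h : History k T) (z : Fin k × ℝ) :
    logLik m (History.append (h, z)) = logLik m h + (m z.1 * z.2 - m z.1 ^ 2 / 2) := by
  simp only [logLik, Fin.sum_univ_castSucc, History.append_castSucc, History.append_last]

theorem measurable_append_left {T : ℕ} (h : History k T) (a : Fin k) :
    Measurable fun x : ℝ => History.append (h, (a, x)) :=
  History.measurable_append.comp (measurable_prodMk_left.comp measurable_prodMk_left)

/-- The policy chooses arms by the same kernels in both environments, so only the ratios of the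
reward densities survive in the likelihood ratio. -/
theorem lintegral_law_gaussianEnv (π : Policy k) (m : Fin k → ℝ)
    (hm : ∀ i j, |m i - m j| ≤ 1) (T : ℕ) {g : History k T → ℝ≥0∞} (hg : Measurable g) :
    ∫⁻ h, g h ∂(law π (gaussianEnv m hm) T) =
      ∫⁻ h, g h * ENNReal.ofReal (Real.exp (logLik m h)) ∂(law π (baseEnv k) T) := by
  induction T with
  | zero => simp [law, logLik]
  | succ T ih =>
    have hL : Measurable fun h : History k T => ENNReal.ofReal (Real.exp (logLik m h)) :=
      (Real.measurable_exp.comp (measurable_logLik m)).ennreal_ofReal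
    have hL' : Measurable fun h : History k (T + 1) =>
        ENNReal.ofReal (Real.exp (logLik m h)) :=
      (Real.measurable_exp.comp (measurable_logLik m)).ennreal_ofReal
    have hd : ∀ a, (baseEnv k).dist a = gaussianReal 0 1 := fun a => rfl
    have hd' : ∀ a, (gaussianEnv m hm).dist a = gaussianReal (m a) 1 := fun a => rfl
    rw [lintegral_law_succ _ _ _ hg, lintegral_law_succ _ _ _
      (show Measurable fun h => g h * ENNReal.ofReal (Real.exp (logLik m h)) from hg.mul hL')]
    have hmeas : Measurable fun h : History k T =>
        ∫⁻ a, ∫⁻ x, g (History.append (h, (a, x))) ∂((gaussianEnv m hm).dist a)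
          ∂(π.kernel T h) := by
      have := (hg.comp History.measurable_append).lintegral_kernel_prod_right'
        (κ := π.kernel T ⊗ₖ Kernel.prodMkLeft (History k T) (gaussianEnv m hm).rewardKernel)
      convert this using 1
      funext h
      simp only [Function.comp_apply]
      rw [Kernel.lintegral_compProd _ _ _ (show Measurable fun z => g (History.append (h, z)) from
        (hg.comp History.measurable_append).comp measurable_prodMk_left)]
      simp [Kernel.prodMkLeft_apply, Environment.rewardKernel_apply]
    rw [ih hmeas]
    refine lintegral_congr fun h => ?_
    rw [mul_comm, ← lintegral_const_mul _ Measurable.of_discrete]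
    refine lintegral_congr fun a => ?_
    have hga : Measurable fun x => g (History.append (h, (a, x))) :=
      hg.comp (measurable_append_left h a)
    rw [hd, hd', lintegral_gaussianReal_eq _ hga, ← lintegral_const_mul _
      (show Measurable fun x => g (History.append (h, (a, x))) *
        ENNReal.ofReal (Real.exp (m a * x - m a ^ 2 / 2)) from hga.mul (by fun_prop))]
    refine lintegral_congr fun x => ?_
    simp only [logLik_append, Real.exp_add]
    rw [ENNReal.ofReal_mul (Real.exp_pos _).le]
    ring

/-- The number of plays of arm `i` in a history. -/
def armCount {T : ℕ} (i : Fin k) (h : History k T) : ℕ :=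
  (Finset.univ.filter fun u => (h u).1 = i).card

theorem single_gap_le {δ : ℝ} (hδ : |δ| ≤ 1) (i a b : Fin k) :
    |(Pi.single i δ : Fin k → ℝ) a - (Pi.single i δ : Fin k → ℝ) b| ≤ 1 := by
  by_cases ha : a = i <;> by_cases hb : b = i <;> simp [ha, hb, hδ]

/-- The Gaussian environment in which arm `i` has mean `δ` and all other arms have mean zero. -/
noncomputable def shiftEnv (i : Fin k) (δ : ℝ) (hδ : |δ| ≤ 1) : Environment k :=
  gaussianEnv (Pi.single i δ) (single_gap_le hδ i)

/-- The terms linear in the rewards cancel. What remains depends only on the number of plays of arm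
`i`, which is what makes opposite shifts useful as a pair. -/
theorem logLik_add_logLik_neg (i : Fin k) (δ : ℝ) {T : ℕ} (h : History k T) :
    logLik (Pi.single i δ) h + logLik (Pi.single i (-δ)) h = -(armCount i h * δ ^ 2) := by
  rw [logLik, logLik, ← Finset.sum_add_distrib, armCount, Finset.card_filter, Nat.cast_sum,
    Finset.sum_mul, ← Finset.sum_neg_distrib]
  refine Finset.sum_congr rfl fun u _ => ?_
  by_cases hu : (h u).1 = i
  · simp [hu]
    ring
  · simp [hu]

theorem measure_shiftEnv_eq_setLIntegral (π : Policy k) (i : Fin k) {δ : ℝ} (hδ : |δ| ≤ 1) {T : ℕ}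
    {E : Set (History k T)} (hE : MeasurableSet E) :
    law π (shiftEnv i δ hδ) T E = ∫⁻ h in E,
      ENNReal.ofReal (Real.exp (logLik (Pi.single i δ) h)) ∂(law π (baseEnv k) T) := by
  rw [← lintegral_indicator_one hE, shiftEnv,
    lintegral_law_gaussianEnv _ _ _ _ (measurable_one.indicator hE), ← lintegral_indicator hE]
  refine lintegral_congr fun h => ?_
  by_cases hh : h ∈ E <;> simp [hh]

/-- The likelihood ratios of the two opposite shifts have a product of at least `exp (-(n * δ ^ 2))`
on `E`. The arithmetic-geometric mean inequality with weights `l` and `l⁻¹` bounds their weighted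
sum from below, and integration over `E` gives the claim. -/
theorem two_mul_exp_mul_measureReal_le (π : Policy k) (i : Fin k) {δ : ℝ} (hδ : |δ| ≤ 1)
    (hδ' : |(-δ)| ≤ 1) {T n : ℕ} {E : Set (History k T)} (hE : MeasurableSet E)
    (hn : ∀ h ∈ E, armCount i h ≤ n) {l : ℝ} (hl : 0 < l) :
    2 * Real.exp (-(n * δ ^ 2) / 2) * (law π (baseEnv k) T).real E ≤
      l * (law π (shiftEnv i δ hδ) T).real E +
        l⁻¹ * (law π (shiftEnv i (-δ) hδ') T).real E := by
  have key : ENNReal.ofReal (2 * Real.exp (-(n * δ ^ 2) / 2)) * law π (baseEnv k) T E ≤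
      ENNReal.ofReal l * law π (shiftEnv i δ hδ) T E +
        ENNReal.ofReal l⁻¹ * law π (shiftEnv i (-δ) hδ') T E := by
    have hm : ∀ c, Measurable fun h : History k T =>
        ENNReal.ofReal (Real.exp (logLik (Pi.single i c) h)) := fun c =>
      (Real.measurable_exp.comp (measurable_logLik _)).ennreal_ofReal
    rw [measure_shiftEnv_eq_setLIntegral _ _ _ hE, measure_shiftEnv_eq_setLIntegral _ _ _ hE,
      ← lintegral_const_mul _ (hm _), ← lintegral_const_mul _ (hm _),
      ← lintegral_add_left ((hm _).const_mul _), ← setLIntegral_const]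
    refine setLIntegral_mono (((hm _).const_mul _).add ((hm _).const_mul _)) fun h hh => ?_
    rw [← ENNReal.ofReal_mul hl.le, ← ENNReal.ofReal_mul (inv_pos.2 hl).le,
      ← ENNReal.ofReal_add (by positivity) (by positivity)]
    refine ENNReal.ofReal_le_ofReal ?_
    set x := logLik (Pi.single i δ) h
    set y := logLik (Pi.single i (-δ)) h
    have hxy : x + y = -(armCount i h * δ ^ 2) := logLik_add_logLik_neg i δ h
    have hcount : (armCount i h : ℝ) ≤ n := by exact_mod_cast hn h hh
    have h1 : Real.exp (-(n * δ ^ 2) / 2) ≤ Real.exp (x / 2) * Real.exp (y / 2) := by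
      rw [← Real.exp_add]
      refine Real.exp_le_exp.2 ?_
      nlinarith [sq_nonneg δ]
    have hx : Real.exp x = Real.exp (x / 2) ^ 2 := by
      rw [← Real.exp_nat_mul]
      congr 1
      push_cast
      ring
    have hy : Real.exp y = Real.exp (y / 2) ^ 2 := by
      rw [← Real.exp_nat_mul]
      congr 1
      push_cast
      ring
    -- The weighted arithmetic-geometric mean inequality, as a completed square.
    have h2 : l * Real.exp x + l⁻¹ * Real.exp y - 2 * (Real.exp (x / 2) * Real.exp (y / 2)) =
        l⁻¹ * (l * Real.exp (x / 2) - Real.exp (y / 2)) ^ 2 := by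
      rw [hx, hy]
      field_simp
      ring
    have h3 : 0 ≤ l⁻¹ * (l * Real.exp (x / 2) - Real.exp (y / 2)) ^ 2 := by positivity
    linarith
  have := ENNReal.toReal_mono (by finiteness) key
  rwa [ENNReal.toReal_mul, ENNReal.toReal_add (by finiteness) (by finiteness),
    ENNReal.toReal_mul, ENNReal.toReal_mul, ENNReal.toReal_ofReal (by positivity),
    ENNReal.toReal_ofReal hl.le, ENNReal.toReal_ofReal (by positivity)] at this

/-- Change of measure for an event that is decided at one of finitely many times `s`, at each of
which the perturbed arm has been played at most `n` times. -/
theorem sq_mul_exp_le_measureReal_shiftEnv (π : Policy k) (i : Fin k) {δ : ℝ} (hδ : |δ| ≤ 1)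
    {T n : ℕ} (F : Finset ℕ) (G : ∀ s, Set (History k s)) (hF : ∀ s ∈ F, s ≤ T)
    (hG : ∀ s, MeasurableSet (G s)) (hn : ∀ s, ∀ h ∈ G s, armCount i h ≤ n)
    (hdisj : ∀ s (hs : s ≤ T) s' (hs' : s' ≤ T) (h : History k T),
      History.take s hs h ∈ G s → History.take s' hs' h ∈ G s' → s = s') {q : ℝ} (hq : 0 < q)
    (hqU : q ≤ (law π (baseEnv k) T).real {h | ∃ s ∈ F, ∃ hs : s ≤ T, h.take s hs ∈ G s}) :
    q ^ 2 * Real.exp (-(n * δ ^ 2)) ≤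
      (law π (shiftEnv i δ hδ) T).real {h | ∃ s ∈ F, ∃ hs : s ≤ T, h.take s hs ∈ G s} := by
  have hδ' : |(-δ)| ≤ 1 := by rwa [abs_neg]
  -- The event splits over the decision time `s`, and each piece is evaluated under the law of the
  -- first `s` rounds. Plays of arm `i` after time `s` therefore do not count against `n`.
  have hU : ∀ D : Environment k,
      (law π D T).real {h | ∃ s ∈ F, ∃ hs : s ≤ T, h.take s hs ∈ G s} =
        ∑ s ∈ F, (law π D s).real (G s) := by
    intro D
    have h1 : {h : History k T | ∃ s ∈ F, ∃ hs : s ≤ T, h.take s hs ∈ G s} =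
        ⋃ s ∈ F, {h | ∃ hs : s ≤ T, h.take s hs ∈ G s} := by
      ext h
      simp
    have h2 : ∀ s ∈ F, ∀ hs : s ≤ T, {h : History k T | ∃ hs : s ≤ T, h.take s hs ∈ G s} =
        History.take s hs ⁻¹' G s := by
      intro s _ hs
      ext h
      simp [hs]
    rw [h1, measureReal_biUnion_finset]
    · refine Finset.sum_congr rfl fun s hs => ?_
      rw [h2 s hs (hF s hs), law_real_take _ _ _ (hG s)]
    · intro s hs s' hs' hne
      refine Set.disjoint_left.2 fun h ⟨h1, h1'⟩ ⟨h2, h2'⟩ => hne ?_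
      exact hdisj s h1 s' h2 h h1' h2'
    · intro s hs
      rw [h2 s hs (hF s hs)]
      exact History.measurable_take _ (hG s)
  set e := Real.exp (-(n * δ ^ 2) / 2) with he
  have he0 : 0 < e := Real.exp_pos _
  have he2 : Real.exp (-(n * δ ^ 2)) = e ^ 2 := by
    rw [he, ← Real.exp_nat_mul]
    congr 1
    push_cast
    ring
  have hle : (law π (shiftEnv i (-δ) hδ') T).real
      {h | ∃ s ∈ F, ∃ hs : s ≤ T, h.take s hs ∈ G s} ≤ 1 := measureReal_le_one
  -- The weight `(q * e)⁻¹` bounds the contribution of the unwanted opposite shift by `q * e`, half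
  -- of the left side's lower bound `2 * q * e`.
  have key : 2 * e * (law π (baseEnv k) T).real
        {h | ∃ s ∈ F, ∃ hs : s ≤ T, h.take s hs ∈ G s} ≤
      (q * e)⁻¹ * (law π (shiftEnv i δ hδ) T).real
          {h | ∃ s ∈ F, ∃ hs : s ≤ T, h.take s hs ∈ G s} +
        (q * e)⁻¹⁻¹ * (law π (shiftEnv i (-δ) hδ') T).real
          {h | ∃ s ∈ F, ∃ hs : s ≤ T, h.take s hs ∈ G s} := by
    simp only [hU, Finset.mul_sum]
    rw [← Finset.sum_add_distrib]
    exact Finset.sum_le_sum fun s _ =>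
      two_mul_exp_mul_measureReal_le π i hδ hδ' (hG s) (hn s) (by positivity)
  rw [inv_inv] at key
  set Q := (law π (shiftEnv i δ hδ) T).real {h | ∃ s ∈ F, ∃ hs : s ≤ T, h.take s hs ∈ G s}
  have hqe : 0 < q * e := by positivity
  have h1 : 2 * (q * e) ≤ (q * e)⁻¹ * Q + q * e := by
    calc 2 * (q * e) = 2 * e * q := by ring
      _ ≤ _ := mul_le_mul_of_nonneg_left hqU (by positivity)
      _ ≤ _ := key
      _ ≤ _ := by nlinarith
  have h2 : q * e ≤ Q / (q * e) := by
    rw [div_eq_inv_mul]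
    linarith
  rw [le_div_iff₀ hqe] at h2
  rw [he2]
  linarith [h2]

end Gaussian

/-! ### Counting switches along a sequence of arms. -/

section Switches

/-- The number of times `t ∈ [u, v)` at which the sequence `a` switches from `a t` to a different
value `a (t + 1)`. -/
def switches (a : ℕ → Fin k) (u v : ℕ) : ℕ :=
  ((Finset.Ico u v).filter fun t => a t ≠ a (t + 1)).card

theorem switches_add (a : ℕ → Fin k) {u v w : ℕ} (huv : u ≤ v) (hvw : v ≤ w) :
    switches a u v + switches a v w = switches a u w := by
  rw [switches, switches, switches, ← Finset.Ico_union_Ico_eq_Ico huv hvw, Finset.filter_union,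
    Finset.card_union_of_disjoint]
  exact Finset.disjoint_filter_filter (Finset.Ico_disjoint_Ico_consecutive u v w)

theorem switches_succ (a : ℕ → Fin k) {u v : ℕ} (huv : u ≤ v) :
    switches a u (v + 1) = switches a u v + if a v ≠ a (v + 1) then 1 else 0 := by
  rw [← switches_add a huv (Nat.le_succ v)]
  congr 1
  rw [switches, Nat.Ico_succ_singleton, Finset.filter_singleton]
  split_ifs <;> simp

theorem switches_mono (a : ℕ → Fin k) {u v w : ℕ} (huv : u ≤ v) (hvw : v ≤ w) :
    switches a u v ≤ switches a u w := by
  rw [← switches_add a huv hvw]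
  exact Nat.le_add_right _ _

theorem eq_of_switches_eq_zero (a : ℕ → Fin k) {u v w : ℕ} (h : switches a u w = 0)
    (huv : u ≤ v) (hvw : v ≤ w) : a v = a u := by
  induction v, huv using Nat.le_induction with
  | base => rfl
  | succ v huv ih =>
    rw [← ih (by omega)]
    by_contra hne
    have hmem : v ∈ (Finset.Ico u w).filter fun t => a t ≠ a (t + 1) := by
      simp only [Finset.mem_filter, Finset.mem_Ico]
      exact ⟨by omega, fun h => hne h.symm⟩
    rw [Finset.card_eq_zero.1 h] at hmem
    simp at hmem

theorem card_image_Icc_le (a : ℕ → Fin k) {u v : ℕ} (huv : u ≤ v) :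
    ((Finset.Icc u v).image a).card ≤ 1 + switches a u v := by
  induction v, huv using Nat.le_induction with
  | base => simp [switches]
  | succ v huv ih =>
    rw [switches_succ a huv, ← Finset.insert_Icc_right_eq_Icc_add_one (by omega),
      Finset.image_insert]
    split_ifs with h
    · exact (Finset.card_insert_le _ _).trans (by omega)
    · rw [Finset.insert_eq_of_mem]
      · exact ih
      · rw [not_not] at h
        rw [← h]
        exact Finset.mem_image_of_mem _ (by simp [huv])

theorem le_switches_of_forall_exists (a : ℕ → Fin k) {u v : ℕ} (huv : u ≤ v)
    (h : ∀ i, ∃ t, u ≤ t ∧ t ≤ v ∧ a t = i) : k - 1 ≤ switches a u v := by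
  have h1 : (Finset.Icc u v).image a = Finset.univ := by
    refine Finset.eq_univ_iff_forall.2 fun i => ?_
    obtain ⟨t, h1, h2, h3⟩ := h i
    exact Finset.mem_image.2 ⟨t, Finset.mem_Icc.2 ⟨h1, h2⟩, h3⟩
  have h2 := card_image_Icc_le a huv
  rw [h1, Finset.card_univ, Fintype.card_fin] at h2
  omega

/-- A sequence that plays every arm between any two consecutive grid points makes so many switches
that it has used up its budget when it meets the last new arm after the last but one grid point. -/
theorem exists_avoided_or_exists_first (hk : 0 < k) (a : ℕ → Fin k) (t : ℕ → ℕ) (M : ℕ) :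
    (∃ j ≤ M, ∃ i, ∀ u, t j ≤ u → u < t (j + 1) → a u ≠ i) ∨
      ∃ s, t M ≤ s ∧ s < t (M + 1) ∧ (∀ u, t M ≤ u → u < s → a u ≠ a s) ∧
        (M + 1) * (k - 1) ≤ switches a 0 s := by
  refine or_iff_not_imp_left.2 fun hneg => ?_
  push Not at hneg
  have hlt : ∀ j ≤ M, t j < t (j + 1) := by
    intro j hj
    obtain ⟨u, h1, h2, -⟩ := hneg j hj ⟨0, hk⟩
    omega
  have hM : ∀ j ≤ M, j * (k - 1) ≤ switches a 0 (t j) := by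
    intro j
    induction j with
    | zero => simp
    | succ j ih =>
      intro hj
      have hj' := hlt j (by omega)
      -- Only switches inside the interval are used, so those of different intervals are disjoint
      -- and add up.
      have h1 := le_switches_of_forall_exists a (u := t j) (v := t (j + 1) - 1) (by omega)
        (fun i => by
          obtain ⟨u, h1, h2, h3⟩ := hneg j (by omega) i
          exact ⟨u, h1, by omega, h3⟩)
      have h2 := switches_mono a (u := t j) (v := t (j + 1) - 1) (w := t (j + 1))
        (by omega) (by omega)
      have h3 := switches_add a (Nat.zero_le (t j)) hj'.le
      have h4 := ih (by omega)
      rw [Nat.add_mul, one_mul]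
      omega
  classical
  have hex : ∃ v, t M ≤ v ∧ ∀ i, ∃ u, t M ≤ u ∧ u ≤ v ∧ a u = i := by
    have := hlt M le_rfl
    refine ⟨t (M + 1) - 1, by omega, fun i => ?_⟩
    obtain ⟨u, h1, h2, h3⟩ := hneg M le_rfl i
    exact ⟨u, h1, by omega, h3⟩
  -- `s` is the first time by which all arms have occurred since `t M`; by minimality the arm at `s`
  -- is new.
  obtain ⟨s, ⟨hs1, hs2⟩, hmin⟩ : ∃ s, (t M ≤ s ∧ ∀ i, ∃ u, t M ≤ u ∧ u ≤ s ∧ a u = i) ∧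
      ∀ v < s, ¬ (t M ≤ v ∧ ∀ i, ∃ u, t M ≤ u ∧ u ≤ v ∧ a u = i) :=
    ⟨Nat.find hex, Nat.find_spec hex, fun v hv => Nat.find_min hex hv⟩
  refine ⟨s, hs1, ?_, ?_, ?_⟩
  · by_contra hcon
    have := hlt M le_rfl
    refine hmin (t (M + 1) - 1) (by omega) ⟨by omega, fun i => ?_⟩
    obtain ⟨u, h1, h2, h3⟩ := hneg M le_rfl i
    exact ⟨u, h1, by omega, h3⟩
  · intro u hu1 hu2 heq
    refine hmin (s - 1) (by omega) ⟨by omega, fun i => ?_⟩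
    obtain ⟨v, h1, h2, h3⟩ := hs2 i
    rcases eq_or_ne v s with rfl | hne
    · exact ⟨u, hu1, by omega, heq.trans h3⟩
    · exact ⟨v, h1, by omega, h3⟩
  · have h1 := le_switches_of_forall_exists a hs1 hs2
    have h2 := switches_add a (Nat.zero_le (t M)) hs1
    have h3 := hM M le_rfl
    rw [Nat.add_mul, one_mul]
    omega

theorem numSwitches_eq_switches {T : ℕ} (h : History k T) (a : ℕ → Fin k)
    (ha : ∀ u : Fin T, a u = (h u).1) : numSwitches h = switches a 0 (T - 1) := by
  rw [numSwitches, switches]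
  refine Finset.card_bij (fun p _ => (p.1 : ℕ)) ?_ ?_ ?_
  · rintro ⟨p, q⟩ hp
    simp only [Finset.mem_filter, Finset.mem_univ, true_and, Finset.mem_Ico] at hp ⊢
    obtain ⟨h1, h2⟩ := hp
    have := q.2
    refine ⟨by omega, ?_⟩
    rwa [h1, ha, ha]
  · rintro ⟨p, q⟩ hp ⟨p', q'⟩ hp' heq
    simp only [Finset.mem_filter, Finset.mem_univ, true_and] at hp hp' heq
    ext <;> simp only <;> omega
  · intro u hu
    simp only [Finset.mem_filter, Finset.mem_Ico] at hu
    refine ⟨(⟨u, by omega⟩, ⟨u + 1, by omega⟩), ?_, rfl⟩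
    simp only [Finset.mem_filter, Finset.mem_univ, true_and]
    rw [← ha, ← ha]
    exact hu.2

theorem exists_arm_sequence (hk : 0 < k) {T : ℕ} (h : History k T) :
    ∃ a : ℕ → Fin k, ∀ u : Fin T, a u = (h u).1 :=
  ⟨fun u => if hu : u < T then (h ⟨u, hu⟩).1 else ⟨0, hk⟩, fun u => by simp⟩

theorem measurableSet_arms {T : ℕ} (P : (Fin T → Fin k) → Prop) :
    MeasurableSet {h : History k T | P fun u => (h u).1} := by
  have : Measurable fun (h : History k T) (u : Fin T) => (h u).1 :=
    measurable_pi_lambda _ fun u => measurable_arm u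
  exact this (MeasurableSet.of_discrete (s := {a | P a}))

theorem armCount_le_of_forall {T n : ℕ} (i : Fin k) (h : History k T)
    (hn : ∀ u : Fin T, (h u).1 = i → (u : ℕ) < n) : armCount i h ≤ n := by
  have : ((Finset.univ.filter fun u : Fin T => (h u).1 = i).image fun u : Fin T => (u : ℕ)) ⊆
      Finset.range n := by
    intro v hv
    simp only [Finset.mem_image, Finset.mem_filter, Finset.mem_univ, true_and] at hv
    obtain ⟨u, h1, rfl⟩ := hv
    exact Finset.mem_range.2 (hn u h1)
  have h2 := Finset.card_le_card this
  rw [Finset.card_image_of_injective _ Fin.val_injective, Finset.card_range] at h2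
  exact h2

theorem mul_le_sum_of_forall_le {T u v : ℕ} (hv : v ≤ T) (f : Fin T → ℝ)
    (hf : ∀ t, 0 ≤ f t) {c : ℝ} (hc : ∀ t : Fin T, u ≤ t → (t : ℕ) < v → c ≤ f t) (huv : u ≤ v) :
    c * ((v : ℝ) - u) ≤ ∑ t, f t := by
  set g : ℕ → ℝ := fun t => if ht : t < T then f ⟨t, ht⟩ else 0 with hg
  have h1 : ∑ t, f t = ∑ t ∈ Finset.range T, g t := by
    rw [← Fin.sum_univ_eq_sum_range]
    simp [hg]
  have h2 : ∑ t ∈ Finset.Ico u v, c ≤ ∑ t ∈ Finset.Ico u v, g t := by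
    refine Finset.sum_le_sum fun t ht => ?_
    rw [Finset.mem_Ico] at ht
    have : t < T := by omega
    simp only [hg, this, dif_pos]
    exact hc _ ht.1 ht.2
  have h3 : ∑ t ∈ Finset.Ico u v, g t ≤ ∑ t ∈ Finset.range T, g t := by
    refine Finset.sum_le_sum_of_subset_of_nonneg ?_ fun t ht _ => ?_
    · intro t ht
      simp only [Finset.mem_Ico, Finset.mem_range] at ht ⊢
      omega
    · simp only [hg]
      split_ifs <;> simp [hf]
  rw [Finset.sum_const, Nat.card_Ico, nsmul_eq_mul, Nat.cast_sub huv] at h2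
  rw [h1]
  linarith

end Switches

/-! ### Skipped arms, forced commitment, and the regret they cause. -/

section LowerBound

/-- The histories of length `m` in which arm `i` is not played from round `u` on. -/
def avoidSet (i : Fin k) (u m s : ℕ) : Set (History k s) :=
  {h | s = m ∧ ∀ v : Fin s, u ≤ v → (h v).1 ≠ i}

/-- The histories in which arm `i` is played for the first time since round `u` in the last round,
and which contain at least `B` switches. -/
def commitSet (i : Fin k) (u B s : ℕ) : Set (History k s) :=
  {h | u + 1 ≤ s ∧ B ≤ numSwitches h ∧ ∀ v : Fin s, u ≤ v → ((h v).1 = i ↔ (v : ℕ) + 1 = s)}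

theorem measurableSet_avoidSet (i : Fin k) (u m s : ℕ) : MeasurableSet (avoidSet i u m s) :=
  measurableSet_arms fun a => s = m ∧ ∀ v : Fin s, u ≤ v → a v ≠ i

theorem measurableSet_commitSet (i : Fin k) (u B s : ℕ) :
    MeasurableSet (commitSet i u B s) :=
  measurableSet_arms fun a => u + 1 ≤ s ∧ B ≤ (Finset.univ.filter fun p : Fin s × Fin s =>
    (p.1 : ℕ) + 1 = (p.2 : ℕ) ∧ a p.1 ≠ a p.2).card ∧
      ∀ v : Fin s, u ≤ v → (a v = i ↔ (v : ℕ) + 1 = s)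

theorem armCount_le_of_mem_avoidSet {i : Fin k} {u m s : ℕ} {h : History k s}
    (hh : h ∈ avoidSet i u m s) : armCount i h ≤ u :=
  armCount_le_of_forall i h fun v hv => by
    by_contra hcon
    exact hh.2 v (by omega) hv

theorem armCount_le_of_mem_commitSet {i : Fin k} {u B s : ℕ} {h : History k s}
    (hh : h ∈ commitSet i u B s) : armCount i h ≤ u + 1 := by
  by_cases hex : ∃ v : Fin s, (v : ℕ) + 1 = s
  · obtain ⟨w, hw⟩ := hex
    have hsub : (Finset.univ.filter fun v => (h v).1 = i) ⊆
        insert w (Finset.univ.filter fun v : Fin s => (v : ℕ) < u) := by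
      intro v hv
      simp only [Finset.mem_filter, Finset.mem_univ, true_and, Finset.mem_insert] at hv ⊢
      by_cases huv : u ≤ v
      · left
        have := (hh.2.2 v huv).1 hv
        ext
        omega
      · right
        omega
    have h1 : (Finset.univ.filter fun v : Fin s => (v : ℕ) < u).card ≤ u := by
      have : (Finset.univ.filter fun v : Fin s => (v : ℕ) < u).image (fun v : Fin s => (v : ℕ)) ⊆
          Finset.range u := by
        intro x hx
        simp only [Finset.mem_image, Finset.mem_filter, Finset.mem_univ, true_and] at hx
        obtain ⟨v, hv, rfl⟩ := hx
        exact Finset.mem_range.2 hv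
      have h2 := Finset.card_le_card this
      rwa [Finset.card_image_of_injective _ Fin.val_injective, Finset.card_range] at h2
    exact (Finset.card_le_card hsub).trans ((Finset.card_insert_le _ _).trans (by omega))
  · refine armCount_le_of_forall i h fun v _ => ?_
    have := hh.1
    exact absurd ⟨⟨s - 1, by omega⟩, by simp only; omega⟩ hex

/-- The last round of the shorter history is the first play of `i` since round `u`, and there is
only one such round. This is the disjointness over decision times required by the change of measure.
-/
theorem commitSet_eq_of_mem {i : Fin k} {u B T s s' : ℕ} (hs : s ≤ T) (hs' : s' ≤ T)
    (h : History k T) (h1 : h.take s hs ∈ commitSet i u B s)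
    (h2 : h.take s' hs' ∈ commitSet i u B s') : s = s' := by
  have key : ∀ {s s' : ℕ} (hs : s ≤ T) (hs' : s' ≤ T), h.take s hs ∈ commitSet i u B s →
      h.take s' hs' ∈ commitSet i u B s' → ¬ s < s' := by
    intro s s' hs hs' h1 h2 hlt
    have hpos := h1.1
    have e1 := (h1.2.2 ⟨s - 1, by omega⟩ (by simp only; omega)).2 (by simp only; omega)
    have e2 := (h2.2.2 ⟨s - 1, by omega⟩ (by simp only; omega)).1 e1
    simp only at e2
    omega
  have := key hs hs' h1 h2
  have := key hs' hs h2 h1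
  omega

/-- The first `s` rounds already use the whole budget `B`, so no switch can follow. -/
theorem arm_eq_of_mem_commitSet (hk : 0 < k) {i : Fin k} {u B T s : ℕ} (hs : s ≤ T)
    {h : History k T} (hB : numSwitches h ≤ B) (h1 : h.take s hs ∈ commitSet i u B s)
    (t : Fin T) (ht : s ≤ t) : (h t).1 = i := by
  obtain ⟨a, ha⟩ := exists_arm_sequence hk h
  have hpos := h1.1
  have htT := t.2
  have e1 : (h.take s hs ⟨s - 1, by omega⟩).1 = i :=
    (h1.2.2 ⟨s - 1, by omega⟩ (by simp only; omega)).2 (by simp only; omega)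
  have e2 : a (s - 1) = i := by
    rw [← e1]
    exact ha ⟨s - 1, by omega⟩
  have n1 := numSwitches_eq_switches (h.take s hs) a fun u => ha (Fin.castLE hs u)
  have n2 := numSwitches_eq_switches h a ha
  have n3 := h1.2.1
  have n4 := switches_add a (Nat.zero_le (s - 1)) (show s - 1 ≤ T - 1 by omega)
  rw [← ha, ← e2]
  exact eq_of_switches_eq_zero a (w := T - 1) (by omega) (by omega) (by omega)

theorem exists_mem_avoidSet_or_commitSet (hk : 0 < k) {t : ℕ → ℕ} (ht : Monotone t)
    {M T : ℕ} (hT : t (M + 1) ≤ T) (h : History k T) :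
    (∃ j ∈ Finset.range (M + 1), ∃ i : Fin k, ∃ s ∈ ({t (j + 1)} : Finset ℕ), ∃ hs : s ≤ T,
        h.take s hs ∈ avoidSet i (t j) (t (j + 1)) s) ∨
      ∃ i : Fin k, ∃ s ∈ Finset.Icc (t M + 1) (t (M + 1)), ∃ hs : s ≤ T,
        h.take s hs ∈ commitSet i (t M) ((M + 1) * (k - 1)) s := by
  obtain ⟨a, ha⟩ := exists_arm_sequence hk h
  rcases exists_avoided_or_exists_first hk a t M with
    ⟨j, hj, i, hi⟩ | ⟨s, hs1, hs2, hs3, hs4⟩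
  · have hjT : t (j + 1) ≤ T := (ht (by omega)).trans hT
    refine Or.inl ⟨j, Finset.mem_range.2 (by omega), i, t (j + 1), Finset.mem_singleton_self _,
      hjT, rfl, fun v hv => ?_⟩
    have := hi v hv v.2
    rwa [show (v : ℕ) = (Fin.castLE hjT v : ℕ) from rfl, ha] at this
  · have hsT : s + 1 ≤ T := by omega
    refine Or.inr ⟨a s, s + 1, Finset.mem_Icc.2 ⟨by omega, by omega⟩, hsT, by omega, ?_, ?_⟩
    · rw [numSwitches_eq_switches (h.take (s + 1) hsT) a fun u => ha (Fin.castLE hsT u)]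
      simpa using hs4
    · intro v hv
      have e : (h.take (s + 1) hsT v).1 = a v := (ha (Fin.castLE hsT v)).symm
      rw [e]
      have hvs := v.2
      constructor
      · intro heq
        by_contra hne
        exact hs3 v hv (by omega) heq
      · intro heq
        have : (v : ℕ) = s := by omega
        rw [this]

/-- A lower bound on the regret of policies that make at most `(M + 1) * (k - 1)` switches, in terms
of a grid of rounds `0 = t 0 ≤ t 1 ≤ ... ≤ t (M + 1) ≤ T`. -/
theorem exists_le_envRegret (hk : 2 ≤ k) {t : ℕ → ℕ} (ht : Monotone t) {M T : ℕ}
    (hT : t (M + 1) ≤ T) {π : Policy k}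
    (hπ : IsSwitchPolicy ((M + 1) * (k - 1)) T π) {B : ℝ} (hB : 0 ≤ B)
    (hgrid : ∀ j ≤ M, B * Real.sqrt (t j + 1) ≤ (t (j + 1) : ℝ) - t j)
    (hlast : B * Real.sqrt (t M + 1) ≤ (T : ℝ) - t (M + 1)) :
    ∃ D : Environment k,
      (1 / (((M : ℝ) + 2) * k)) ^ 2 * Real.exp (-1) * B ≤ envRegret π T D := by
  have hk0 : 0 < k := by omega
  -- There are `(M + 1) * k` ways to skip an arm in an interval and `k` ways to commit to one.
  set p : ℝ := 1 / (((M : ℝ) + 2) * k) with hp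
  have hp0 : 0 < p := by positivity
  set P := (law π (baseEnv k) T).real with hP
  set E : ℕ → Fin k → Set (History k T) := fun j i =>
    {h | ∃ s ∈ ({t (j + 1)} : Finset ℕ), ∃ hs : s ≤ T,
        h.take s hs ∈ avoidSet i (t j) (t (j + 1)) s} with hE
  set C : Fin k → Set (History k T) := fun i =>
    {h | ∃ s ∈ Finset.Icc (t M + 1) (t (M + 1)), ∃ hs : s ≤ T,
        h.take s hs ∈ commitSet i (t M) ((M + 1) * (k - 1)) s} with hC
  have hδ : ∀ j, 0 < 1 / Real.sqrt (t j + 1) ∧ 1 / Real.sqrt (t j + 1) ≤ 1 := by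
    intro j
    have h1 : 1 ≤ Real.sqrt (t j + 1) := by
      rw [Real.one_le_sqrt]
      have : (0 : ℝ) ≤ t j := Nat.cast_nonneg _
      linarith
    refine ⟨by positivity, ?_⟩
    rw [div_le_one (by linarith)]
    exact h1
  -- With at most `t j + 1` plays, a shift by `1 / √(t j + 1)` costs only a constant factor in
  -- probability.
  have hexp : ∀ j, Real.exp (-1) ≤
      Real.exp (-(((t j + 1 : ℕ) : ℝ) * (1 / Real.sqrt (t j + 1)) ^ 2)) := by
    intro j
    have h0 : (0 : ℝ) < t j + 1 := by positivity
    rw [div_pow, Real.sq_sqrt h0.le]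
    push_cast
    refine Real.exp_le_exp.2 (le_of_eq ?_)
    field_simp
  have hBd : ∀ j x, B * Real.sqrt (t j + 1) ≤ x → B ≤ 1 / Real.sqrt (t j + 1) * x := by
    intro j x hx
    rw [one_div, ← div_eq_inv_mul, le_div_iff₀ (by positivity)]
    exact hx
  have hex : (∃ j ≤ M, ∃ i, p ≤ P (E j i)) ∨ ∃ i, p ≤ P (C i) := by
    by_contra hcon
    push Not at hcon
    obtain ⟨hc1, hc2⟩ := hcon
    have hcover : Set.univ ⊆ (⋃ j ∈ Finset.range (M + 1), ⋃ i ∈ (Finset.univ : Finset (Fin k)),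
        E j i) ∪ ⋃ i ∈ (Finset.univ : Finset (Fin k)), C i := by
      intro h _
      rcases exists_mem_avoidSet_or_commitSet hk0 ht hT h with ⟨j, hj, i, hi⟩ | ⟨i, hi⟩
      · exact Or.inl (Set.mem_biUnion hj (Set.mem_biUnion (Finset.mem_univ i) hi))
      · exact Or.inr (Set.mem_biUnion (Finset.mem_univ i) hi)
    have h1 : (1 : ℝ) ≤ ∑ j ∈ Finset.range (M + 1), ∑ i, P (E j i) + ∑ i, P (C i) := by
      calc (1 : ℝ) = P Set.univ := by simp [hP]
        _ ≤ _ := measureReal_mono hcover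
        _ ≤ _ := measureReal_union_le _ _
        _ ≤ _ := by
          refine add_le_add ?_ (measureReal_biUnion_finset_le _ _)
          refine (measureReal_biUnion_finset_le _ _).trans ?_
          exact Finset.sum_le_sum fun j _ => measureReal_biUnion_finset_le _ _
    have h2 : ∑ j ∈ Finset.range (M + 1), ∑ i, P (E j i) + ∑ i, P (C i) <
        ∑ j ∈ Finset.range (M + 1), ∑ _i : Fin k, p + ∑ _i : Fin k, p := by
      have hne : (Finset.univ : Finset (Fin k)).Nonempty := ⟨⟨0, hk0⟩, Finset.mem_univ _⟩
      refine add_lt_add_of_le_of_lt ?_ ?_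
      · exact Finset.sum_le_sum fun j hj => Finset.sum_le_sum fun i _ =>
          (hc1 j (by rw [Finset.mem_range] at hj; omega) i).le
      · exact Finset.sum_lt_sum_of_nonempty hne fun i _ => hc2 i
    have h3 : ∑ j ∈ Finset.range (M + 1), ∑ _i : Fin k, p + ∑ _i : Fin k, p = 1 := by
      simp only [Finset.sum_const, Finset.card_univ, Fintype.card_fin, Finset.card_range,
        nsmul_eq_mul, hp]
      push_cast
      field_simp
      ring
    linarith
  have hmU : ∀ (F : Finset ℕ) (G : ∀ s, Set (History k s)), (∀ s, MeasurableSet (G s)) →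
      MeasurableSet {h : History k T | ∃ s ∈ F, ∃ hs : s ≤ T, h.take s hs ∈ G s} := by
    intro F G hG
    have : {h : History k T | ∃ s ∈ F, ∃ hs : s ≤ T, h.take s hs ∈ G s} =
        ⋃ s ∈ F, ⋃ hs : s ≤ T, History.take s hs ⁻¹' G s := by
      ext h
      simp
    rw [this]
    exact F.measurableSet_biUnion fun s _ => MeasurableSet.iUnion fun hs =>
      History.measurable_take hs (hG s)
  rcases hex with ⟨j, hj, i, hi⟩ | ⟨i, hi⟩
  · have hd : |1 / Real.sqrt (t j + 1)| ≤ 1 := by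
      rw [abs_of_pos (hδ j).1]
      exact (hδ j).2
    have hjT : t (j + 1) ≤ T := (ht (by omega)).trans hT
    have htr := sq_mul_exp_le_measureReal_shiftEnv π i hd (n := t j + 1) {t (j + 1)}
      (fun s => avoidSet i (t j) (t (j + 1)) s) (by simpa using hjT)
      (fun s => measurableSet_avoidSet _ _ _ _)
      (fun s h hh => (armCount_le_of_mem_avoidSet hh).trans (Nat.le_succ _))
      (fun s hs s' hs' h h1 h2 => h1.1.trans h2.1.symm) hp0 hi
    refine ⟨shiftEnv i _ hd, ?_⟩
    set D := shiftEnv i _ hd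
    have hreg := mul_measureReal_le_envRegret π T D
      (hmU {t (j + 1)} (fun s => avoidSet i (t j) (t (j + 1)) s)
        fun s => measurableSet_avoidSet _ _ _ _) (c := B) (ae_of_all _ fun h hh => by
          obtain ⟨s, hs, hsT, hmem⟩ := hh
          rw [Finset.mem_singleton] at hs
          subst hs
          refine (hBd j _ (hgrid j hj)).trans ?_
          refine mul_le_sum_of_forall_le hjT _
            (fun v => sub_nonneg.2 (D.mean_le_bestMean (h v).1)) (fun v hv1 hv2 => ?_)
            (ht (Nat.le_succ j))
          have hne : (h v).1 ≠ i := hmem.2 ⟨v, hv2⟩ hv1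
          have h1 : D.mean (h v).1 = 0 := by
            simp only [D, shiftEnv, gaussianEnv_mean]
            exact Pi.single_eq_of_ne hne _
          have h2 : D.mean i = 1 / Real.sqrt (t j + 1) := by
            simp only [D, shiftEnv, gaussianEnv_mean]
            exact Pi.single_eq_same _ _
          have h3 := D.mean_le_bestMean i
          linarith)
    refine le_trans ?_ hreg
    rw [mul_comm _ B]
    refine mul_le_mul_of_nonneg_left (le_trans ?_ htr) hB
    exact mul_le_mul_of_nonneg_left (hexp j) (by positivity)
  -- The arm to which the policy is committed is made worse, so every later round pays the gap to
  -- any other arm.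
  · have hd : |(-(1 / Real.sqrt (t M + 1)))| ≤ 1 := by
      rw [abs_neg, abs_of_pos (hδ M).1]
      exact (hδ M).2
    have htr := sq_mul_exp_le_measureReal_shiftEnv π i hd (n := t M + 1)
      (Finset.Icc (t M + 1) (t (M + 1)))
      (fun s => commitSet i (t M) ((M + 1) * (k - 1)) s)
      (fun s hs => (Finset.mem_Icc.1 hs).2.trans hT)
      (fun s => measurableSet_commitSet _ _ _ _)
      (fun s h hh => armCount_le_of_mem_commitSet hh)
      (fun s hs s' hs' h h1 h2 => commitSet_eq_of_mem hs hs' h h1 h2) hp0 hi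
    refine ⟨shiftEnv i _ hd, ?_⟩
    set D := shiftEnv i _ hd
    have hreg := mul_measureReal_le_envRegret π T D
      (hmU (Finset.Icc (t M + 1) (t (M + 1)))
        (fun s => commitSet i (t M) ((M + 1) * (k - 1)) s)
        fun s => measurableSet_commitSet _ _ _ _) (c := B) (by
          -- The switch budget is invoked in the perturbed environment `D`, where the regret is
          -- measured.
          filter_upwards [hπ D] with h hsw hh
          obtain ⟨s, hs, hsT, hmem⟩ := hh
          rw [Finset.mem_Icc] at hs
          refine (hBd M _ hlast).trans ?_
          refine mul_le_sum_of_forall_le le_rfl _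
            (fun v => sub_nonneg.2 (D.mean_le_bestMean (h v).1)) (fun v hv1 hv2 => ?_) hT
          have hne : (h v).1 = i := arm_eq_of_mem_commitSet hk0 hsT hsw hmem v (by omega)
          obtain ⟨i', hi'⟩ : ∃ i' : Fin k, i' ≠ i := by
            have : Nontrivial (Fin k) := Fin.nontrivial_iff_two_le.2 hk
            exact exists_ne i
          have h1 : D.mean (h v).1 = -(1 / Real.sqrt (t M + 1)) := by
            simp only [D, shiftEnv, gaussianEnv_mean, hne]
            exact Pi.single_eq_same _ _
          have h2 : D.mean i' = 0 := by
            simp only [D, shiftEnv, gaussianEnv_mean]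
            exact Pi.single_eq_of_ne hi' _
          have h3 := D.mean_le_bestMean i'
          linarith)
    refine le_trans ?_ hreg
    rw [mul_comm _ B]
    refine mul_le_mul_of_nonneg_left (le_trans ?_ htr) hB
    rw [neg_sq]
    exact mul_le_mul_of_nonneg_left (hexp M) (by positivity)

end LowerBound

/-! ### Choice of the grid, and the two necessity statements. -/

section LowerRate

theorem exists_rpow_le_envRegret (hk : 2 ≤ k) {M T : ℕ}
    (hT : Real.log 8 ≤ (1 / 2 : ℝ) ^ (M + 1) * Real.log T) {π : Policy k}
    (hπ : IsSwitchPolicy ((M + 1) * (k - 1)) T π) :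
    ∃ D : Environment k,
      (1 / (((M : ℝ) + 2) * k)) ^ 2 * Real.exp (-1) *
        ((T : ℝ) ^ (1 / (2 - (1 / 2 : ℝ) ^ M)) / 8) ≤ envRegret π T D := by
  have hlog8 : 0 < Real.log 8 := Real.log_pos (by norm_num)
  have hlogT : 0 < Real.log T :=
    pos_of_mul_pos_right (hlog8.trans_le hT) (by positivity)
  have hT0 : (0 : ℝ) < T := by
    rcases Nat.eq_zero_or_pos T with h | h
    · simp [h] at hlogT
    · exact_mod_cast h
  have hTlog : (T : ℝ) = Real.exp (Real.log T) := (Real.exp_log hT0).symm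
  have hx : ∀ j : ℕ, 0 < (1 / 2 : ℝ) ^ j ∧ (1 / 2 : ℝ) ^ j ≤ 1 := fun j =>
    ⟨by positivity, pow_le_one₀ (by norm_num) (by norm_num)⟩
  set b : ℝ := 1 / (2 - (1 / 2 : ℝ) ^ M) with hb
  have hden : 0 < 2 - (1 / 2 : ℝ) ^ M := by linarith [(hx M).2]
  have hb0 : 0 < b := by positivity
  have hbhalf : 1 / 2 ≤ b := by
    rw [hb]
    exact one_div_le_one_div_of_le hden (by linarith [(hx M).1])
  set L : ℝ := b * Real.log T with hL
  have hL0 : 0 < L := mul_pos hb0 hlogT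
  set R : ℝ := (T : ℝ) ^ b with hR
  have hRexp : R = Real.exp L := by
    rw [hR, Real.rpow_def_of_pos hT0, mul_comm]
  -- `s j = R ^ (1 - 2 ^ (-j))` solves `s (j + 1) ^ 2 = R * s j` with `s 0 = 1`, so interval length
  -- over square root of its starting point is always of order `R`; the exponent `b` of `R` is
  -- chosen to give `s (M + 1) ^ 2 = T`.
  set s : ℕ → ℝ := fun j => Real.exp (L * (1 - (1 / 2 : ℝ) ^ j)) with hs
  have hs1 : ∀ j, 1 ≤ s j := fun j =>
    Real.one_le_exp (mul_nonneg hL0.le (by linarith [(hx j).2]))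
  have hsmono : Monotone s := by
    intro i j hij
    refine Real.exp_le_exp.2 (mul_le_mul_of_nonneg_left ?_ hL0.le)
    linarith [pow_le_pow_of_le_one (show (0 : ℝ) ≤ 1 / 2 by norm_num) (by norm_num) hij]
  have hssucc : ∀ j, s (j + 1) ^ 2 = R * s j := by
    intro j
    rw [hRexp, hs, ← Real.exp_nat_mul, ← Real.exp_add]
    congr 1
    rw [pow_succ]
    push_cast
    ring
  have hsM : s (M + 1) ^ 2 = T := by
    rw [hs, ← Real.exp_nat_mul, hTlog]
    congr 1
    rw [pow_succ, hL, hb, div_mul_eq_mul_div, one_mul, Nat.cast_ofNat, mul_comm, mul_assoc,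
      div_mul_eq_mul_div, div_eq_iff hden.ne']
    ring
  -- This separates consecutive grid points: `s (j + 1) ^ 2` is at least eight times `s j ^ 2`.
  have hR8 : ∀ j ≤ M, 8 * s j ≤ R := by
    intro j hj
    have h1 : Real.log 8 ≤ L * (1 / 2 : ℝ) ^ j := by
      calc Real.log 8 ≤ (1 / 2 : ℝ) ^ (M + 1) * Real.log T := hT
        _ = (1 / 2 * Real.log T) * (1 / 2 : ℝ) ^ M := by rw [pow_succ]; ring
        _ ≤ L * (1 / 2 : ℝ) ^ j := by
          refine mul_le_mul (mul_le_mul_of_nonneg_right hbhalf hlogT.le) ?_ (hx M).1.le hL0.le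
          exact pow_le_pow_of_le_one (by norm_num) (by norm_num) hj
    calc 8 * s j = Real.exp (Real.log 8) * s j := by rw [Real.exp_log (by norm_num)]
      _ ≤ Real.exp (L * (1 / 2 : ℝ) ^ j) * s j :=
        mul_le_mul_of_nonneg_right (Real.exp_le_exp.2 h1) (by linarith [hs1 j])
      _ = R := by
        rw [hs, ← Real.exp_add, hRexp]
        congr 1
        ring
  -- Halving leaves at least `T / 2` rounds after `t (M + 1)`, in which a committed policy pays.
  set t : ℕ → ℕ := fun j => ⌊s j ^ 2 / 2⌋₊ with ht
  have htle : ∀ j, (t j : ℝ) ≤ s j ^ 2 / 2 := fun j => Nat.floor_le (by positivity)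
  have htlt : ∀ j, s j ^ 2 / 2 < t j + 1 := fun j => Nat.lt_floor_add_one _
  have htmono : Monotone t := by
    intro i j hij
    refine Nat.floor_le_floor ?_
    have h1 := hsmono hij
    have h2 := hs1 i
    have : s i ^ 2 ≤ s j ^ 2 := pow_le_pow_left₀ (by linarith) h1 2
    linarith
  have hsqrt : ∀ j, Real.sqrt (t j + 1) ≤ 2 * s j := by
    intro j
    rw [Real.sqrt_le_left (by linarith [hs1 j])]
    nlinarith [htle j, hs1 j]
  have hR0 : 0 < R := by
    rw [hRexp]
    exact Real.exp_pos _
  refine exists_le_envRegret hk htmono (M := M) ?_ hπ (B := R / 8) (by positivity) ?_ ?_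
  · have := htle (M + 1)
    rw [hsM] at this
    have h2 : (t (M + 1) : ℝ) ≤ T := by linarith
    exact_mod_cast h2
  · intro j hj
    have h1 := htlt (j + 1)
    have h2 := htle j
    have h3 := hR8 j hj
    have h4 := hs1 j
    have h5 : R / 8 * Real.sqrt (t j + 1) ≤ R / 8 * (2 * s j) :=
      mul_le_mul_of_nonneg_left (hsqrt j) (by positivity)
    rw [hssucc] at h1
    have h6 : 8 * s j ^ 2 ≤ R * s j := by nlinarith
    have h7 : 1 ≤ s j ^ 2 := by nlinarith
    nlinarith
  · have h1 := htle (M + 1)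
    have h5 : R / 8 * Real.sqrt (t M + 1) ≤ R / 8 * (2 * s M) :=
      mul_le_mul_of_nonneg_left (hsqrt M) (by positivity)
    have h6 := hssucc M
    have h7 : 0 < R * s M := mul_pos hR0 (by linarith [hs1 M])
    rw [hsM] at h1 h6
    nlinarith

theorem IsSwitchPolicy.mono {S S' T : ℕ} {π : Policy k} (h : IsSwitchPolicy S T π)
    (hS : S ≤ S') : IsSwitchPolicy S' T π := fun D => by
  filter_upwards [h D] with w hw
  exact hw.trans hS

theorem envRegret_le_of_regret_le {π : Policy k} {T : ℕ} {x : ℝ} (h : regret π T ≤ (x : EReal))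
    (D : Environment k) : envRegret π T D ≤ x :=
  EReal.coe_le_coe_iff.1 ((le_iSup (fun D => (envRegret π T D : EReal)) D).trans h)

theorem two_rpow_neg_natCast (N : ℕ) : (2 : ℝ) ^ (-(N : ℝ)) = (1 / 2 : ℝ) ^ N := by
  rw [Real.rpow_neg (by norm_num), Real.rpow_natCast, one_div, inv_pow]

theorem eventually_mul_log_pow_mul_rpow_lt (C : ℝ) (p : ℕ) {a b c : ℝ} (hab : a < b)
    (hc : 0 < c) :
    ∀ᶠ T : ℕ in atTop, C * Real.log T ^ p * (T : ℝ) ^ a < c * (T : ℝ) ^ b := by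
  have h1 : (fun x : ℝ => Real.log x ^ (p : ℝ)) =o[atTop] fun x => x ^ (b - a) :=
    isLittleO_log_rpow_rpow_atTop _ (by linarith)
  have h2 := (h1.def (c := c / (2 * (|C| + 1))) (by positivity)).natCast_atTop
  filter_upwards [h2, eventually_ge_atTop 1] with T hT hT1
  have hT0 : (0 : ℝ) < T := by exact_mod_cast hT1
  have hlog : 0 ≤ Real.log T := Real.log_nonneg (by exact_mod_cast hT1)
  rw [Real.rpow_natCast, Real.norm_of_nonneg (by positivity),
    Real.norm_of_nonneg (by positivity)] at hT
  have h3 : C * Real.log T ^ p ≤ c / 2 * (T : ℝ) ^ (b - a) := by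
    calc C * Real.log T ^ p ≤ (|C| + 1) * Real.log T ^ p :=
        mul_le_mul_of_nonneg_right (by linarith [le_abs_self C]) (by positivity)
      _ ≤ (|C| + 1) * (c / (2 * (|C| + 1)) * (T : ℝ) ^ (b - a)) :=
        mul_le_mul_of_nonneg_left hT (by positivity)
      _ = _ := by field_simp
  calc C * Real.log T ^ p * (T : ℝ) ^ a ≤ c / 2 * (T : ℝ) ^ (b - a) * (T : ℝ) ^ a :=
      mul_le_mul_of_nonneg_right h3 (by positivity)
    _ = c / 2 * (T : ℝ) ^ b := by
      rw [mul_assoc, ← Real.rpow_add hT0]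
      congr 2
      ring
    _ < c * (T : ℝ) ^ b := mul_lt_mul_of_pos_right (by linarith) (by positivity)

theorem budget_necessary (hk : 2 ≤ k) {N : ℕ} (hN : 1 ≤ N) (π : ℕ → Policy k)
    (hπ : IsSoftO (fun T => regret (π T) T)
      (fun T => (T : ℝ) ^ ((1 : ℝ) / (2 - (2 : ℝ) ^ (-(N : ℝ)))))) :
    ∀ᶠ T : ℕ in atTop, ∀ S : ℕ, IsSwitchPolicy S T (π T) → N * (k - 1) + 1 ≤ S := by
  obtain ⟨M, rfl⟩ : ∃ M, N = M + 1 := ⟨N - 1, by omega⟩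
  obtain ⟨C, p, hC⟩ := hπ
  simp only [two_rpow_neg_natCast] at hC
  have hk0 : (0 : ℝ) < k := by exact_mod_cast (show 0 < k by omega)
  have hpow : (1 / 2 : ℝ) ^ (M + 1) < (1 / 2 : ℝ) ^ M :=
    pow_lt_pow_right_of_lt_one₀ (by norm_num) (by norm_num) (Nat.lt_succ_self M)
  have hM1 : (1 / 2 : ℝ) ^ M ≤ 1 := pow_le_one₀ (by norm_num) (by norm_num)
  have hlt : 1 / (2 - (1 / 2 : ℝ) ^ (M + 1)) < 1 / (2 - (1 / 2 : ℝ) ^ M) :=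
    one_div_lt_one_div_of_lt (by linarith) (by linarith)
  have hc : 0 < (1 / (((M : ℝ) + 2) * k)) ^ 2 * Real.exp (-1) / 8 := by positivity
  have hlog : Tendsto (fun T : ℕ => (1 / 2 : ℝ) ^ (M + 1) * Real.log T) atTop atTop :=
    (Real.tendsto_log_atTop.comp tendsto_natCast_atTop_atTop).const_mul_atTop (by positivity)
  filter_upwards [hC, hlog.eventually_ge_atTop (Real.log 8),
    eventually_mul_log_pow_mul_rpow_lt C p hlt hc] with T h1 h2 h3 S hS
  by_contra hcon
  obtain ⟨D, hD⟩ := exists_rpow_le_envRegret hk h2 (hS.mono (by omega))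
  have h4 := envRegret_le_of_regret_le h1 D
  have : (1 / (((M : ℝ) + 2) * k)) ^ 2 * Real.exp (-1) *
      ((T : ℝ) ^ (1 / (2 - (1 / 2 : ℝ) ^ M)) / 8) =
      (1 / (((M : ℝ) + 2) * k)) ^ 2 * Real.exp (-1) / 8 *
        (T : ℝ) ^ (1 / (2 - (1 / 2 : ℝ) ^ M)) := by ring
  linarith

theorem eventually_mul_pow_lt_exp (C : ℝ) (n : ℕ) :
    ∀ᶠ y : ℝ in atTop, C * y ^ n < Real.exp (y / 4) := by
  have h := (isLittleO_pow_exp_pos_mul_atTop n (b := 1 / 4) (by norm_num)).def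
    (c := 1 / (2 * (|C| + 1))) (by positivity)
  filter_upwards [h, eventually_ge_atTop 0] with y hy hy0
  rw [Real.norm_of_nonneg (by positivity), Real.norm_of_nonneg (by positivity)] at hy
  have he : Real.exp (1 / 4 * y) = Real.exp (y / 4) := by
    congr 1
    ring
  rw [he] at hy
  have hexp := Real.exp_pos (y / 4)
  calc C * y ^ n ≤ (|C| + 1) * y ^ n :=
      mul_le_mul_of_nonneg_right (by linarith [le_abs_self C]) (by positivity)
    _ ≤ (|C| + 1) * (1 / (2 * (|C| + 1)) * Real.exp (y / 4)) :=
      mul_le_mul_of_nonneg_left hy (by positivity)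
    _ = Real.exp (y / 4) / 2 := by field_simp
    _ < _ := by linarith

/-- In terms of `y = √(log T)`, a budget below `log y` forces regret of at least `√T * exp (y / 4)`
divided by a power of `y`, up to a constant, whereas powers of `log T` are powers of `y`. -/
theorem loglog_necessary (hk : 2 ≤ k) (π : ℕ → Policy k)
    (hπ : IsSoftO (fun T => regret (π T) T) (fun T => Real.sqrt T)) :
    ∀ᶠ T : ℕ in atTop, ∀ S : ℕ, IsSwitchPolicy S T (π T) →
      (1 / 2 : ℝ) * Real.log (Real.log T) ≤ S := by
  obtain ⟨C, p, hC⟩ := hπ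
  have hk0 : (0 : ℝ) < k := by exact_mod_cast (show 0 < k by omega)
  have hlog : Tendsto (fun T : ℕ => Real.log T) atTop atTop :=
    Real.tendsto_log_atTop.comp tendsto_natCast_atTop_atTop
  have hsqrt : Tendsto (fun T : ℕ => Real.sqrt (Real.log T)) atTop atTop :=
    Real.tendsto_sqrt_atTop.comp hlog
  filter_upwards [hC, hsqrt.eventually_ge_atTop (2 * Real.log 8 + 2),
    hsqrt.eventually (eventually_mul_pow_lt_exp (|C| * ((2 * k) ^ 2 * Real.exp 1 * 8))
      (2 * p + 4))] with T h1 h2 h3 S hS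
  by_contra hcon
  push Not at hcon
  have hlog8 : 0 < Real.log 8 := Real.log_pos (by norm_num)
  set y := Real.sqrt (Real.log T) with hy
  have hy2 : 2 ≤ y := by linarith
  have hlogT : Real.log T = y ^ 2 := by
    refine (Real.sq_sqrt ?_).symm
    by_contra hneg
    rw [hy, Real.sqrt_eq_zero_of_nonpos (by linarith)] at hy2
    linarith
  have hT0 : (0 : ℝ) < T := by
    rcases Nat.eq_zero_or_pos T with h | h
    · simp [h] at hlogT
      nlinarith
    · exact_mod_cast h
  have hlogy : Real.log (Real.log T) = 2 * Real.log y := by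
    rw [hlogT, Real.log_pow]
    norm_num
  rw [hlogy] at hcon
  have hSy : (S : ℝ) < Real.log y := by linarith
  have hlogy0 : 0 ≤ Real.log y := Real.log_nonneg (by linarith)
  -- `2 ^ S ≤ exp S ≤ y`, since `log 2 ≤ 1`.
  have hpow : 1 / y ≤ (1 / 2 : ℝ) ^ S := by
    have e1 : (1 / 2 : ℝ) ^ S = Real.exp (-(S * Real.log 2)) := by
      rw [Real.exp_neg, Real.exp_nat_mul, Real.exp_log (by norm_num), one_div, inv_pow]
    have e2 : 1 / y = Real.exp (-Real.log y) := by
      rw [Real.exp_neg, Real.exp_log (by linarith), one_div]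
    rw [e1, e2]
    refine Real.exp_le_exp.2 (neg_le_neg ?_)
    have hl2 : Real.log 2 ≤ 1 := by
      have := Real.log_le_sub_one_of_pos (show (0 : ℝ) < 2 by norm_num)
      linarith
    nlinarith [Nat.cast_nonneg (α := ℝ) S, Real.log_pos (show (1 : ℝ) < 2 by norm_num)]
  have hpow' : y ≤ (1 / 2 : ℝ) ^ S * Real.log T := by
    rw [hlogT]
    calc y = 1 / y * y ^ 2 := by field_simp
      _ ≤ _ := mul_le_mul_of_nonneg_right hpow (by positivity)
  have hcond : Real.log 8 ≤ (1 / 2 : ℝ) ^ (S + 1) * Real.log T := by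
    rw [pow_succ]
    linarith
  -- A crude choice of `M = S`; it only affects the constant `c`, and `1 / 2` serves for all `k`.
  have hsw : IsSwitchPolicy ((S + 1) * (k - 1)) T (π T) := by
    refine hS.mono ?_
    calc S ≤ (S + 1) * 1 := by omega
      _ ≤ _ := Nat.mul_le_mul_left _ (by omega)
  obtain ⟨D, hD⟩ := exists_rpow_le_envRegret hk hcond hsw
  have h4 := envRegret_le_of_regret_le h1 D
  have hsT : 0 < Real.sqrt T := Real.sqrt_pos.2 hT0
  have hrate : Real.sqrt T * Real.exp (y / 4) ≤ (T : ℝ) ^ (1 / (2 - (1 / 2 : ℝ) ^ S)) := by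
    rw [Real.sqrt_eq_rpow, Real.rpow_def_of_pos hT0, Real.rpow_def_of_pos hT0, ← Real.exp_add]
    refine Real.exp_le_exp.2 ?_
    set x := (1 / 2 : ℝ) ^ S with hx
    have hx1 : x ≤ 1 := pow_le_one₀ (by norm_num) (by norm_num)
    have hx0 : 0 < x := by positivity
    have h5 : 1 / 2 + x / 4 ≤ 1 / (2 - x) := by
      rw [le_div_iff₀ (by linarith)]
      nlinarith
    have h6 : 0 ≤ Real.log T := by
      rw [hlogT]
      positivity
    nlinarith [mul_le_mul_of_nonneg_left h5 h6]
  -- The prefactor of the lower bound decays with the number of epochs, but only like a power of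
  -- `y`.
  have hS2 : (S : ℝ) + 2 ≤ 2 * y ^ 2 := by
    have := Real.log_le_sub_one_of_pos (show 0 < y by linarith)
    nlinarith
  have hp : 1 / (2 * y ^ 2 * k) ≤ 1 / (((S : ℝ) + 2) * k) :=
    one_div_le_one_div_of_le (by positivity) (mul_le_mul_of_nonneg_right hS2 hk0.le)
  have h7 : (1 / (2 * y ^ 2 * k)) ^ 2 * Real.exp (-1) *
      (Real.sqrt T * Real.exp (y / 4) / 8) ≤ |C| * Real.log T ^ p * Real.sqrt T := by
    calc _ ≤ (1 / (((S : ℝ) + 2) * k)) ^ 2 * Real.exp (-1) *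
        ((T : ℝ) ^ (1 / (2 - (1 / 2 : ℝ) ^ S)) / 8) := by gcongr
      _ ≤ C * Real.log T ^ p * Real.sqrt T := hD.trans h4
      _ ≤ _ := by
        rw [hlogT]
        gcongr
        exact le_abs_self C
  have h8 : Real.exp (y / 4) ≤ |C| * ((2 * k) ^ 2 * Real.exp 1 * 8) * y ^ (2 * p + 4) := by
    rw [hlogT, Real.exp_neg] at h7
    have e1 : (1 / (2 * y ^ 2 * k)) ^ 2 * (Real.exp 1)⁻¹ *
        (Real.sqrt T * Real.exp (y / 4) / 8) =
        Real.exp (y / 4) * Real.sqrt T / ((2 * k) ^ 2 * Real.exp 1 * 8 * y ^ 4) := by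
      field_simp
    rw [e1, div_le_iff₀ (by positivity)] at h7
    have e2 : |C| * (y ^ 2) ^ p * Real.sqrt T * ((2 * k) ^ 2 * Real.exp 1 * 8 * y ^ 4) =
        |C| * ((2 * k) ^ 2 * Real.exp 1 * 8) * y ^ (2 * p + 4) * Real.sqrt T := by
      ring
    rw [e2] at h7
    exact le_of_mul_le_mul_right h7 hsT
  linarith

end LowerRate

/-! ### The alternating schedule and its switch count. -/

section Schedule

/-- The first round of epoch `l`, if epoch `j` consists of `k` slots of `n j` rounds each. -/
def epochStart (k : ℕ) (n : ℕ → ℕ) (l : ℕ) : ℕ := ∑ j ∈ Finset.range l, k * n j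

/-- The epoch to which round `t` belongs. -/
def epoch (k : ℕ) (n : ℕ → ℕ) (t : ℕ) : ℕ := Nat.findGreatest (fun l => epochStart k n l ≤ t) t

/-- The slot of its epoch to which round `t` belongs. -/
def slot (k : ℕ) (n : ℕ → ℕ) (t : ℕ) : ℕ :=
  (t - epochStart k n (epoch k n t)) / n (epoch k n t)

theorem epochStart_succ (n : ℕ → ℕ) (l : ℕ) :
    epochStart k n (l + 1) = epochStart k n l + k * n l :=
  Finset.sum_range_succ _ _

variable {n : ℕ → ℕ}

theorem epochStart_strictMono (hk : 0 < k) (hn : ∀ l, 0 < n l) :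
    StrictMono (epochStart k n) :=
  strictMono_nat_of_lt_succ fun l => by
    rw [epochStart_succ]
    have := Nat.mul_pos hk (hn l)
    omega

theorem epochStart_epoch_le (t : ℕ) : epochStart k n (epoch k n t) ≤ t := by
  have h0 : epochStart k n 0 ≤ t := by simp [epochStart]
  exact Nat.findGreatest_spec (P := fun l => epochStart k n l ≤ t) (Nat.zero_le t) h0

theorem epoch_eq_of_le_of_lt (hk : 0 < k) (hn : ∀ l, 0 < n l) {l t : ℕ}
    (h1 : epochStart k n l ≤ t) (h2 : t < epochStart k n (l + 1)) : epoch k n t = l := by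
  have hm := epochStart_strictMono hk hn
  have hl : l ≤ t := (hm.le_apply (x := l)).trans h1
  have h3 : l ≤ epoch k n t :=
    Nat.le_findGreatest (P := fun l => epochStart k n l ≤ t) hl h1
  have h4 : epoch k n t < l + 1 := hm.lt_iff_lt.1 ((epochStart_epoch_le t).trans_lt h2)
  omega

theorem lt_epochStart_epoch_succ (hk : 0 < k) (hn : ∀ l, 0 < n l) (t : ℕ) :
    t < epochStart k n (epoch k n t + 1) := by
  by_contra hcon
  rw [not_lt] at hcon
  have hm := epochStart_strictMono hk hn
  have hl : epoch k n t + 1 ≤ t := (hm.le_apply (x := epoch k n t + 1)).trans hcon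
  have := Nat.le_findGreatest (P := fun l => epochStart k n l ≤ t) hl hcon
  exact absurd this (by rw [← epoch]; omega)

theorem slot_lt (hk : 0 < k) (hn : ∀ l, 0 < n l) (t : ℕ) : slot k n t < k := by
  have h1 := lt_epochStart_epoch_succ hk hn t
  rw [epochStart_succ] at h1
  refine Nat.div_lt_of_lt_mul ?_
  rw [mul_comm]
  have := epochStart_epoch_le (k := k) (n := n) t
  omega

theorem epoch_slot_succ (hk : 0 < k) (hn : ∀ l, 0 < n l) (t : ℕ) :
    (epoch k n (t + 1) = epoch k n t ∧ slot k n t ≤ slot k n (t + 1)) ∨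
      (epoch k n (t + 1) = epoch k n t + 1 ∧ slot k n t = k - 1 ∧ slot k n (t + 1) = 0) := by
  have h1 := lt_epochStart_epoch_succ hk hn t
  have h2 := epochStart_epoch_le (k := k) (n := n) t
  rcases Nat.lt_or_ge (t + 1) (epochStart k n (epoch k n t + 1)) with h3 | h3
  · have h4 := epoch_eq_of_le_of_lt hk hn (h2.trans (Nat.le_succ t)) h3
    refine Or.inl ⟨h4, ?_⟩
    rw [slot, slot, h4]
    exact Nat.div_le_div_right (by omega)
  · have h4 : epoch k n (t + 1) = epoch k n t + 1 :=
      epoch_eq_of_le_of_lt hk hn h3 (by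
        have := epochStart_strictMono hk hn (Nat.lt_succ_self (epoch k n t + 1))
        simp only [Nat.succ_eq_add_one] at this
        omega)
    refine Or.inr ⟨h4, ?_, ?_⟩
    · rw [epochStart_succ] at h1 h3
      have hnl := hn (epoch k n t)
      have e : t - epochStart k n (epoch k n t) = k * n (epoch k n t) - 1 := by omega
      rw [slot, e]
      have h5 : k * n (epoch k n t) = (k - 1) * n (epoch k n t) + n (epoch k n t) := by
        rw [← Nat.succ_mul, Nat.succ_eq_add_one, Nat.sub_add_cancel hk]
      refine Nat.div_eq_of_lt_le ?_ ?_
      · omega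
      · rw [Nat.succ_mul]
        omega
    · rw [slot, h4]
      have : t + 1 - epochStart k n (epoch k n t + 1) = 0 := by omega
      rw [this, Nat.zero_div]

/-- A single slot of epoch `N` is longer than `t`, so its second slot is never reached. -/
theorem epoch_le_of_lt (hk : 0 < k) (hn : ∀ l, 0 < n l) {N t : ℕ} (ht : t < n N) :
    epoch k n t ≤ N ∧ (epoch k n t = N → slot k n t = 0) := by
  have h1 := epochStart_epoch_le (k := k) (n := n) t
  constructor
  · by_contra hcon
    have h2 := (epochStart_strictMono hk hn).monotone (show N + 1 ≤ epoch k n t by omega)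
    rw [epochStart_succ] at h2
    have := Nat.le_mul_of_pos_left (n N) hk
    omega
  · intro he
    rw [slot, he]
    exact Nat.div_eq_of_lt (by omega)

/-- The order in which the arms are scheduled in epoch `l`: increasing in even epochs, decreasing in
odd ones. -/
def orient (l : ℕ) (b : Fin k) : Fin k := if Even l then b else b.rev

theorem orient_orient (l : ℕ) (b : Fin k) : orient l (orient l b) = b := by
  unfold orient
  split_ifs <;> simp

/-- The first arm of `A` that is at least `b`, and the largest arm of `A` if there is none. -/
def play (A : Finset (Fin k)) (b : Fin k) : Fin k :=
  if h : (A.filter (b ≤ ·)).Nonempty then (A.filter (b ≤ ·)).min' h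
  else if h' : A.Nonempty then A.max' h' else b

theorem play_mem {A : Finset (Fin k)} (hA : A.Nonempty) (b : Fin k) : play A b ∈ A := by
  unfold play
  split_ifs with h
  · exact (Finset.mem_filter.1 (Finset.min'_mem _ h)).1
  · exact Finset.max'_mem _ _

theorem play_of_mem {A : Finset (Fin k)} {b : Fin k} (hb : b ∈ A) : play A b = b := by
  have hb' : b ∈ A.filter (b ≤ ·) := Finset.mem_filter.2 ⟨hb, le_rfl⟩
  have h : (A.filter (b ≤ ·)).Nonempty := ⟨b, hb'⟩
  rw [play, dif_pos h]
  exact le_antisymm (Finset.min'_le _ _ hb')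
    (Finset.mem_filter.1 (Finset.min'_mem _ h)).2

theorem play_mono {A : Finset (Fin k)} (hA : A.Nonempty) : Monotone (play A) := by
  intro b c hbc
  by_cases hc : (A.filter (c ≤ ·)).Nonempty
  · have hsub : A.filter (c ≤ ·) ⊆ A.filter (b ≤ ·) := fun a ha => by
      rw [Finset.mem_filter] at ha ⊢
      exact ⟨ha.1, hbc.trans ha.2⟩
    rw [play, play, dif_pos hc, dif_pos (hc.mono hsub)]
    exact Finset.min'_subset hc hsub
  · have e : play A c = A.max' hA := by rw [play, dif_neg hc, dif_pos hA]
    rw [e]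
    exact Finset.le_max' _ _ (play_mem hA b)

variable [NeZero k]

/-- The arm for which round `t` is scheduled. -/
def target (n : ℕ → ℕ) (t : ℕ) : Fin k := orient (epoch k n t) (Fin.ofNat k (slot k n t))

/-- A sequence of arms that follows the schedule, playing in each epoch only arms from a nonempty
set, where these sets are decreasing. -/
structure FollowsSchedule (n : ℕ → ℕ) (A : ℕ → Finset (Fin k)) (a : ℕ → Fin k) : Prop where
  nonempty : ∀ l, (A l).Nonempty
  antitone : ∀ l, A (l + 1) ⊆ A l
  eq_play : ∀ t, a t = play (A (epoch k n t)) (target n t)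

variable {A : ℕ → Finset (Fin k)} {a : ℕ → Fin k}

/-- `play` is monotone for a fixed set of arms, so the played arms move in the direction of the
schedule even where slots of eliminated arms are refilled. -/
theorem FollowsSchedule.same_epoch (h : FollowsSchedule n A a) (hn : ∀ l, 0 < n l) {t : ℕ}
    (he : epoch k n (t + 1) = epoch k n t) (hs : slot k n t ≤ slot k n (t + 1)) :
    (orient (epoch k n t) (a t) : ℕ) ≤ orient (epoch k n (t + 1)) (a (t + 1)) := by
  have hk : 0 < k := Nat.pos_of_ne_zero (NeZero.ne k)
  rw [h.eq_play, h.eq_play, target, target, he]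
  have hle : Fin.ofNat k (slot k n t) ≤ Fin.ofNat k (slot k n (t + 1)) := by
    rw [Fin.le_def]
    simp only [Fin.val_ofNat, Nat.mod_eq_of_lt (slot_lt hk hn _)]
    exact hs
  rw [← Fin.le_def]
  unfold orient
  split_ifs
  · exact play_mono (h.nonempty _) hle
  · exact Fin.rev_le_rev.2 (play_mono (h.nonempty _) (Fin.rev_le_rev.2 hle))

/-- Both sides of the boundary are scheduled for the same arm. If the new epoch begins with that
arm, the arm was also active before (the sets decrease), hence was being played, and no switch
occurs. A switch thus skips position zero. -/
theorem FollowsSchedule.next_epoch (h : FollowsSchedule n A a) {t : ℕ}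
    (he : epoch k n (t + 1) = epoch k n t + 1) (hs : slot k n t = k - 1)
    (hs' : slot k n (t + 1) = 0) (hne : a t ≠ a (t + 1)) :
    0 < (orient (epoch k n (t + 1)) (a (t + 1)) : ℕ) := by
  have hk : 0 < k := Nat.pos_of_ne_zero (NeZero.ne k)
  have htar : (target n t : Fin k) = target n (t + 1) := by
    have h1 : Fin.ofNat k (k - 1) = (Fin.ofNat k 0).rev := by
      ext
      simp only [Fin.val_ofNat, Fin.val_rev, Nat.zero_mod, Nat.mod_eq_of_lt (Nat.sub_lt hk one_pos)]
      omega
    rw [target, target, hs, hs', he, orient, orient, h1]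
    by_cases hev : Even (epoch k n t) <;> simp [hev, Nat.even_add_one]
  refine Nat.pos_of_ne_zero fun hzero => hne ?_
  have h2 : a (t + 1) = target n (t + 1) := by
    have h3 : orient (epoch k n (t + 1)) (a (t + 1)) = Fin.ofNat k (slot k n (t + 1)) := by
      ext
      rw [hzero, hs']
      simp
    rw [target, ← h3, orient_orient]
  have h4 : a (t + 1) ∈ A (epoch k n t) := by
    have := play_mem (h.nonempty (epoch k n (t + 1))) (target n (t + 1))
    rw [← h.eq_play, he] at this
    exact h.antitone _ this
  have h5 : a t = target n t := by
    rw [h.eq_play]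
    refine play_of_mem ?_
    rwa [htar, ← h2]
  rw [h5, h2, htar]

/-- A potential argument: within an epoch each switch raises the position of the played arm, and a
switch at a boundary is paid for by the positive starting position. -/
theorem FollowsSchedule.switches_le_add_orient (h : FollowsSchedule n A a)
    (hn : ∀ l, 0 < n l) (t : ℕ) :
    switches a 0 t ≤ epoch k n t * (k - 1) + orient (epoch k n t) (a t) := by
  have hk : 0 < k := Nat.pos_of_ne_zero (NeZero.ne k)
  induction t with
  | zero => simp [switches]
  | succ t ih =>
    rw [switches_succ a (Nat.zero_le t)]
    rcases epoch_slot_succ hk hn t with ⟨he, hs⟩ | ⟨he, hs, hs'⟩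
    · have h1 := h.same_epoch hn he hs
      split_ifs with hne
      · have h2 : (orient (epoch k n t) (a t) : ℕ) ≠ orient (epoch k n (t + 1)) (a (t + 1)) := by
          intro heq
          rw [he] at heq
          have h3 := congrArg (orient (epoch k n t)) (Fin.ext heq)
          rw [orient_orient, orient_orient] at h3
          exact hne h3
        rw [he] at h1 h2 ⊢
        omega
      · rw [he] at h1 ⊢
        omega
    · have h1 : (orient (epoch k n t) (a t) : ℕ) ≤ k - 1 := Nat.le_sub_one_of_lt (Fin.is_lt _)
      have h2 : epoch k n (t + 1) * (k - 1) = epoch k n t * (k - 1) + (k - 1) := by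
        rw [he, Nat.succ_mul]
      split_ifs with hne
      · have := h.next_epoch he hs hs' hne
        omega
      · omega

/-- During the first slot the arm is constant, so at most the one switch on entering the epoch is
added to the `k - 1` per earlier epoch. -/
theorem FollowsSchedule.switches_le_of_slot_eq_zero (h : FollowsSchedule n A a)
    (hn : ∀ l, 0 < n l) (t : ℕ) (ht : slot k n t = 0) :
    switches a 0 t ≤ epoch k n t * (k - 1) + 1 := by
  have hk : 0 < k := Nat.pos_of_ne_zero (NeZero.ne k)
  induction t with
  | zero => simp [switches]
  | succ t ih =>
    rw [switches_succ a (Nat.zero_le t)]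
    rcases epoch_slot_succ hk hn t with ⟨he, hs⟩ | ⟨he, hs, hs'⟩
    · have hst : slot k n t = 0 := by omega
      have h1 : a t = a (t + 1) := by
        rw [h.eq_play, h.eq_play, target, target, he, hst, ht]
      rw [if_neg (not_not.2 h1), he]
      exact ih hst
    · have h0 := h.switches_le_add_orient hn t
      have h1 : (orient (epoch k n t) (a t) : ℕ) ≤ k - 1 := Nat.le_sub_one_of_lt (Fin.is_lt _)
      have h2 : epoch k n (t + 1) * (k - 1) = epoch k n t * (k - 1) + (k - 1) := by
        rw [he, Nat.succ_mul]
      split_ifs <;> omega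

theorem FollowsSchedule.switches_le (h : FollowsSchedule n A a) (hn : ∀ l, 0 < n l) {N t : ℕ}
    (ht : t < n N) : switches a 0 t ≤ N * (k - 1) + 1 := by
  have hk : 0 < k := Nat.pos_of_ne_zero (NeZero.ne k)
  obtain ⟨h1, h2⟩ := epoch_le_of_lt hk hn ht
  rcases Nat.lt_or_ge (epoch k n t) N with h3 | h3
  · have h4 := h.switches_le_add_orient hn t
    have h5 : (orient (epoch k n t) (a t) : ℕ) ≤ k - 1 := Nat.le_sub_one_of_lt (Fin.is_lt _)
    have h6 := Nat.mul_le_mul_right (k - 1) (show epoch k n t + 1 ≤ N from h3)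
    rw [Nat.succ_mul] at h6
    omega
  · have h4 : epoch k n t = N := by omega
    rw [← h4]
    exact h.switches_le_of_slot_eq_zero hn t (h2 h4)

end Schedule

/-! ### Policies that are functions of the history. -/

section Deterministic

/-- A policy that chooses the arm as a function of the history. -/
noncomputable def Policy.ofFun (f : ∀ t, History k t → Fin k) (hf : ∀ t, Measurable (f t)) :
    Policy k where
  kernel t := Kernel.deterministic (f t) (hf t)
  isMarkovKernel _ := inferInstance

theorem ae_eq_ofFun (f : ∀ t, History k t → Fin k) (hf : ∀ t, Measurable (f t))
    (D : Environment k) (T : ℕ) :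
    ∀ᵐ h ∂(law (Policy.ofFun f hf) D T), ∀ t : Fin T, (h t).1 = f t (h.take t t.2.le) := by
  have hmeas : ∀ T, MeasurableSet
      {h : History k T | ∀ t : Fin T, (h t).1 = f t (h.take t t.2.le)} := by
    intro T
    rw [Set.ofPred_forall]
    exact MeasurableSet.iInter fun t => measurableSet_eq_fun (measurable_arm t)
      ((hf t).comp (History.measurable_take _))
  induction T with
  | zero => exact ae_of_all _ fun h t => t.elim0
  | succ T ih =>
    rw [ae_iff, ← Set.compl_ofPred, ← lintegral_indicator_one (hmeas (T + 1)).compl,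
      lintegral_law_succ _ _ _ (measurable_one.indicator (hmeas (T + 1)).compl)]
    refine (lintegral_congr_ae ?_).trans lintegral_zero
    filter_upwards [ih] with h hh
    have hker : (Policy.ofFun f hf).kernel T h = Measure.dirac (f T h) :=
      Kernel.deterministic_apply (hf T) _
    rw [hker, lintegral_dirac]
    refine (lintegral_congr fun x => ?_).trans lintegral_zero
    refine Set.indicator_of_notMem ?_ _
    rw [Set.notMem_compl_iff]
    intro t
    refine Fin.lastCases ?_ (fun s => ?_) t
    · rw [History.append_last]
      exact congrArg (f T) (funext fun u => (History.append_castSucc h _ u).symm)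
    · rw [History.append_castSucc, hh s]
      congr 1
      funext u
      exact (History.append_castSucc h _ (Fin.castLE s.2.le u)).symm

end Deterministic

/-! ### Sub-Gaussian concentration under adaptive arm choice. -/

section Concentration

/-- The sum over the rounds in `W` of the deviation of the reward from the mean of the arm. -/
noncomputable def deviation (D : Environment k) (W : Finset ℕ) {T : ℕ} (h : History k T) : ℝ :=
  ∑ t : Fin T, if (t : ℕ) ∈ W then (h t).2 - D.mean (h t).1 else 0

theorem measurable_deviation (D : Environment k) (W : Finset ℕ) {T : ℕ} :
    Measurable (deviation D W : History k T → ℝ) := by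
  refine Finset.measurable_fun_sum _ fun t _ => ?_
  split_ifs
  · exact (measurable_reward t).sub (measurable_arm_fun D.mean t)
  · exact measurable_const

theorem deviation_append (D : Environment k) (W : Finset ℕ) {T : ℕ} (h : History k T)
    (z : Fin k × ℝ) : deviation D W (History.append (h, z)) =
      deviation D W h + if T ∈ W then z.2 - D.mean z.1 else 0 := by
  simp [deviation, Fin.sum_univ_castSucc, History.append_castSucc, History.append_last]

theorem Environment.lintegral_exp_le (D : Environment k) (a : Fin k) (s : ℝ) :
    ∫⁻ x, ENNReal.ofReal (Real.exp (s * (x - D.mean a))) ∂(D.dist a) ≤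
      ENNReal.ofReal (Real.exp (s ^ 2 / 2)) := by
  have h := D.subgaussian a
  have h2 := h.mgf_le s
  rw [NNReal.coe_one, one_mul] at h2
  simp only [Environment.mean]
  rw [← ofReal_integral_eq_lintegral_ofReal (h.integrable_exp_mul s)
    (ae_of_all _ fun x => (Real.exp_pos _).le)]
  exact ENNReal.ofReal_le_ofReal h2

/-- Given the past and the chosen arm, the centred reward is sub-Gaussian whichever arm it is. As
`W` is a fixed set of rounds, each round in it contributes one factor `exp (s ^ 2 / 2)`, with no
loss for adaptivity. -/
theorem lintegral_exp_deviation_le (π : Policy k) (D : Environment k) (W : Finset ℕ) (s : ℝ)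
    (T : ℕ) :
    ∫⁻ h, ENNReal.ofReal (Real.exp (s * deviation D W h)) ∂(law π D T) ≤
      ENNReal.ofReal (Real.exp (((W.filter (· < T)).card : ℝ) * (s ^ 2 / 2))) := by
  induction T with
  | zero => simp [law, deviation]
  | succ T ih =>
    have hm : ∀ {T}, Measurable fun h : History k T =>
        ENNReal.ofReal (Real.exp (s * deviation D W h)) := fun {T} =>
      (Real.measurable_exp.comp ((measurable_deviation D W).const_mul s)).ennreal_ofReal
    rw [lintegral_law_succ _ _ _ hm]
    by_cases hT : T ∈ W
    · have hcard : (W.filter (· < T + 1)).card = (W.filter (· < T)).card + 1 := by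
        have : W.filter (· < T + 1) = insert T (W.filter (· < T)) := by
          ext x
          simp only [Finset.mem_filter, Finset.mem_insert]
          constructor
          · rintro ⟨h1, h2⟩
            by_cases hx : x = T
            · exact Or.inl hx
            · exact Or.inr ⟨h1, by omega⟩
          · rintro (rfl | ⟨h1, h2⟩)
            · exact ⟨hT, by omega⟩
            · exact ⟨h1, by omega⟩
        rw [this, Finset.card_insert_of_notMem (by simp)]
      calc _ ≤ ∫⁻ h, ENNReal.ofReal (Real.exp (s * deviation D W h)) *
            ENNReal.ofReal (Real.exp (s ^ 2 / 2)) ∂(law π D T) := by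
            refine lintegral_mono fun h => ?_
            have hstep : ∀ a, ∫⁻ x, ENNReal.ofReal
                (Real.exp (s * deviation D W (History.append (h, (a, x))))) ∂(D.dist a) ≤
                ENNReal.ofReal (Real.exp (s * deviation D W h)) *
                  ENNReal.ofReal (Real.exp (s ^ 2 / 2)) := by
              intro a
              simp only [deviation_append, hT, if_true, mul_add, Real.exp_add,
                ENNReal.ofReal_mul (Real.exp_pos _).le]
              rw [lintegral_const_mul _ (by fun_prop)]
              gcongr
              exact D.lintegral_exp_le a s
            refine (lintegral_mono fun a => hstep a).trans ?_
            simp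
        _ ≤ ENNReal.ofReal (Real.exp (((W.filter (· < T)).card : ℝ) * (s ^ 2 / 2))) *
            ENNReal.ofReal (Real.exp (s ^ 2 / 2)) := by
            rw [lintegral_mul_const _ hm]
            gcongr
        _ = _ := by
            rw [← ENNReal.ofReal_mul (Real.exp_pos _).le, ← Real.exp_add, hcard]
            push_cast
            ring_nf
    · have hcard : W.filter (· < T + 1) = W.filter (· < T) := by
        ext x
        simp only [Finset.mem_filter]
        refine and_congr_right fun hx => ?_
        have : x ≠ T := fun h => hT (h ▸ hx)
        omega
      rw [hcard]
      simpa [deviation_append, hT] using ih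

theorem measureReal_le_mul_deviation_le (π : Policy k) (D : Environment k) (W : Finset ℕ) (T : ℕ)
    (s c : ℝ) :
    (law π D T).real {h | c ≤ s * deviation D W h} ≤
      Real.exp ((W.card : ℝ) * (s ^ 2 / 2) - c) := by
  have hm : Measurable fun h : History k T =>
      ENNReal.ofReal (Real.exp (s * deviation D W h)) :=
    (Real.measurable_exp.comp ((measurable_deviation D W).const_mul s)).ennreal_ofReal
  have h1 := mul_meas_ge_le_lintegral₀ (μ := law π D T) hm.aemeasurable
    (ENNReal.ofReal (Real.exp c))
  have h2 : {h : History k T | ENNReal.ofReal (Real.exp c) ≤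
      ENNReal.ofReal (Real.exp (s * deviation D W h))} =
      {h | c ≤ s * deviation D W h} := by
    ext h
    simp only [Set.mem_ofPred_eq]
    rw [ENNReal.ofReal_le_ofReal_iff (Real.exp_pos _).le, Real.exp_le_exp]
  rw [h2] at h1
  have h3 : ENNReal.ofReal (Real.exp (((W.filter (· < T)).card : ℝ) * (s ^ 2 / 2))) ≤
      ENNReal.ofReal (Real.exp ((W.card : ℝ) * (s ^ 2 / 2))) := by
    refine ENNReal.ofReal_le_ofReal (Real.exp_le_exp.2 ?_)
    refine mul_le_mul_of_nonneg_right ?_ (by positivity)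
    exact_mod_cast Finset.card_filter_le _ _
  have h4 := ENNReal.toReal_mono ENNReal.ofReal_ne_top
    (h1.trans ((lintegral_exp_deviation_le π D W s T).trans h3))
  rw [ENNReal.toReal_mul, ENNReal.toReal_ofReal (Real.exp_pos _).le,
    ENNReal.toReal_ofReal (Real.exp_pos _).le] at h4
  rw [Real.exp_sub, le_div_iff₀ (Real.exp_pos _), mul_comm]
  exact h4

/-- The Chernoff bound with the optimal parameters `r` and `-r` for the two tails. -/
theorem measureReal_lt_abs_deviation_le (π : Policy k) (D : Environment k) (W : Finset ℕ)
    (T : ℕ) {r : ℝ} (hr : 0 ≤ r) :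
    (law π D T).real {h | W.card * r < |deviation D W h|} ≤
      2 * Real.exp (-(W.card * r ^ 2) / 2) := by
  have hsub : {h : History k T | W.card * r < |deviation D W h|} ⊆
      {h | W.card * r ^ 2 ≤ r * deviation D W h} ∪
        {h | W.card * r ^ 2 ≤ (-r) * deviation D W h} := by
    intro h hh
    simp only [Set.mem_ofPred_eq, Set.mem_union] at hh ⊢
    rcases lt_abs.1 hh with h1 | h1
    · left
      nlinarith
    · right
      nlinarith
  have h1 := measureReal_le_mul_deviation_le π D W T r (W.card * r ^ 2)
  have h2 := measureReal_le_mul_deviation_le π D W T (-r) (W.card * r ^ 2)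
  have e : ∀ x : ℝ, x * (r ^ 2 / 2) - x * r ^ 2 = -(x * r ^ 2) / 2 := fun x => by ring
  rw [neg_sq, e] at h2
  rw [e] at h1
  calc _ ≤ _ := measureReal_mono hsub
    _ ≤ _ := measureReal_union_le _ _
    _ ≤ _ := by linarith

end Concentration

/-! ### The elimination policy as a function of the rewards. -/

section Elimination

/-- The sequence of rewards of a history, continued by zeros. -/
def rewardSeq {t : ℕ} (h : History k t) (s : ℕ) : ℝ := if hs : s < t then (h ⟨s, hs⟩).2 else 0

theorem measurable_rewardSeq {t : ℕ} : Measurable (rewardSeq : History k t → ℕ → ℝ) := by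
  refine measurable_pi_lambda _ fun s => ?_
  unfold rewardSeq
  split_ifs with hs
  · exact measurable_reward _
  · exact measurable_const

/-- The rounds of epoch `l` that are scheduled for arm `a`. -/
def window (n : ℕ → ℕ) (l : ℕ) (a : Fin k) : Finset ℕ :=
  Finset.Ico (epochStart k n l + orient l a * n l)
    (epochStart k n l + orient l a * n l + n l)

theorem card_window (n : ℕ → ℕ) (l : ℕ) (a : Fin k) : (window n l a).card = n l := by
  rw [window, Nat.card_Ico]
  omega

theorem lt_of_mem_window {n : ℕ → ℕ} {l : ℕ} {a : Fin k} {t : ℕ} (ht : t ∈ window n l a) :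
    t < epochStart k n (l + 1) := by
  rw [window, Finset.mem_Ico] at ht
  have h1 : ((orient l a : ℕ) + 1) * n l ≤ k * n l := Nat.mul_le_mul_right _ (Fin.is_lt _)
  rw [Nat.add_mul, one_mul] at h1
  rw [epochStart_succ]
  omega

variable [NeZero k]

theorem epoch_target_of_mem_window {n : ℕ → ℕ} (hn : ∀ l, 0 < n l) {l : ℕ} {a : Fin k} {t : ℕ}
    (ht : t ∈ window n l a) : epoch k n t = l ∧ target n t = a := by
  have hk : 0 < k := Nat.pos_of_ne_zero (NeZero.ne k)
  have hlt := lt_of_mem_window ht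
  rw [window, Finset.mem_Ico] at ht
  have he : epoch k n t = l := epoch_eq_of_le_of_lt hk hn (by omega) hlt
  refine ⟨he, ?_⟩
  have hs : slot k n t = orient l a := by
    rw [slot, he]
    refine Nat.div_eq_of_lt_le ?_ ?_
    · omega
    · rw [Nat.succ_mul]
      omega
  rw [target, he, hs, Fin.ofNat_val_eq_self, orient_orient]

/-- The average reward in the rounds of epoch `l` that are scheduled for arm `a`. -/
noncomputable def estimate (n : ℕ → ℕ) (l : ℕ) (a : Fin k) (x : ℕ → ℝ) : ℝ :=
  (∑ t ∈ window n l a, x t) / n l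

/-- The arms that have not been eliminated before epoch `l`, where `r l` is the confidence radius of
epoch `l` and `x` the sequence of rewards. -/
noncomputable def active (k : ℕ) [NeZero k] (n : ℕ → ℕ) (r : ℕ → ℝ) :
    ℕ → (ℕ → ℝ) → Finset (Fin k)
  | 0, _ => Finset.univ
  | l + 1, x => (active k n r l x).filter fun a =>
      ∀ b ∈ active k n r l x, estimate n l b x ≤ estimate n l a x + 2 * r l

/-- The arm played in round `t` if `x` is the sequence of rewards. -/
noncomputable def elimArm (k : ℕ) [NeZero k] (n : ℕ → ℕ) (r : ℕ → ℝ) (t : ℕ) (x : ℕ → ℝ) :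
    Fin k :=
  play (active k n r (epoch k n t) x) (target n t)

variable {n : ℕ → ℕ} {r : ℕ → ℝ}

theorem mem_active_succ {l : ℕ} {x : ℕ → ℝ} {a : Fin k} :
    a ∈ active k n r (l + 1) x ↔ a ∈ active k n r l x ∧
      ∀ b ∈ active k n r l x, estimate n l b x ≤ estimate n l a x + 2 * r l := by
  rw [active, Finset.mem_filter]

theorem active_nonempty (hr : ∀ l, 0 ≤ r l) (l : ℕ) (x : ℕ → ℝ) :
    (active k n r l x).Nonempty := by
  induction l with
  | zero => exact Finset.univ_nonempty
  | succ l ih =>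
    obtain ⟨a, ha, hmax⟩ := Finset.exists_max_image _ (fun a => estimate n l a x) ih
    exact ⟨a, mem_active_succ.2 ⟨ha, fun b hb => by linarith [hmax b hb, hr l]⟩⟩

theorem followsSchedule_elimArm (hr : ∀ l, 0 ≤ r l) (x : ℕ → ℝ) :
    FollowsSchedule n (fun l => active k n r l x) fun t => elimArm k n r t x where
  nonempty l := active_nonempty hr l x
  antitone _ _ ha := (mem_active_succ.1 ha).1
  eq_play _ := rfl

theorem active_congr {l : ℕ} {x y : ℕ → ℝ} (hn : ∀ l, 0 < n l)
    (h : ∀ t < epochStart k n l, x t = y t) : active k n r l x = active k n r l y := by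
  induction l with
  | zero => rfl
  | succ l ih =>
    have hk : 0 < k := Nat.pos_of_ne_zero (NeZero.ne k)
    have hA := ih fun t ht => h t (ht.trans (epochStart_strictMono hk hn (Nat.lt_succ_self l)))
    have hE : ∀ a : Fin k, estimate n l a x = estimate n l a y := fun a => by
      rw [estimate, estimate]
      congr 1
      exact Finset.sum_congr rfl fun t ht => h t (lt_of_mem_window ht)
    rw [active, active, hA]
    simp only [hE]

/-- The rule is non-anticipating: eliminations use completed epochs only. This justifies padding the
observed rewards by zeros. -/
theorem elimArm_congr {t : ℕ} {x y : ℕ → ℝ} (hn : ∀ l, 0 < n l)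
    (h : ∀ s < t, x s = y s) : elimArm k n r t x = elimArm k n r t y := by
  rw [elimArm, elimArm, active_congr hn fun s hs => h s (hs.trans_le (epochStart_epoch_le t))]

theorem measurableSet_mem_active (l : ℕ) (a : Fin k) :
    MeasurableSet {x : ℕ → ℝ | a ∈ active k n r l x} := by
  induction l generalizing a with
  | zero => simp [active]
  | succ l ih =>
    have hE : ∀ b : Fin k, Measurable fun x : ℕ → ℝ => estimate n l b x := fun b =>
      (Finset.measurable_fun_sum _ fun t _ => measurable_pi_apply t).div_const _
    simp only [mem_active_succ, Set.ofPred_and, Set.ofPred_forall, imp_iff_not_or, Set.ofPred_or]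
    refine (ih a).inter (MeasurableSet.iInter fun b => ?_)
    exact (ih b).compl.union (measurableSet_le (hE b) ((hE a).add_const _))

theorem measurable_elimArm (t : ℕ) : Measurable (elimArm k n r t) := by
  have hA : ∀ S : Finset (Fin k),
      MeasurableSet {x : ℕ → ℝ | active k n r (epoch k n t) x = S} := by
    intro S
    simp only [Finset.ext_iff, Set.ofPred_forall]
    refine MeasurableSet.iInter fun a => ?_
    by_cases ha : a ∈ S
    · simpa [ha] using measurableSet_mem_active _ a
    · simp only [ha, iff_false]
      exact (measurableSet_mem_active _ a).compl
  refine measurable_to_countable' fun i => ?_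
  have : elimArm k n r t ⁻¹' {i} =
      ⋃ S : {S : Finset (Fin k) // play S (target n t) = i},
        {x : ℕ → ℝ | active k n r (epoch k n t) x = S} := by
    ext x
    simp [elimArm]
  rw [this]
  exact MeasurableSet.iUnion fun S => hA S

/-- The policy that plays the arms in a fixed schedule and eliminates arms between epochs. -/
noncomputable def elimPolicy (k : ℕ) [NeZero k] (n : ℕ → ℕ) (r : ℕ → ℝ) : Policy k :=
  Policy.ofFun (fun t h => elimArm k n r t (rewardSeq h))
    fun t => (measurable_elimArm t).comp measurable_rewardSeq

theorem ae_eq_elimArm (hn : ∀ l, 0 < n l) (D : Environment k) (T : ℕ) :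
    ∀ᵐ h ∂(law (elimPolicy k n r) D T), ∀ t : Fin T, (h t).1 = elimArm k n r t (rewardSeq h) := by
  filter_upwards [ae_eq_ofFun (fun t h => elimArm k n r t (rewardSeq h))
    (fun t => (measurable_elimArm t).comp measurable_rewardSeq) D T] with h hh t
  rw [hh t]
  refine elimArm_congr hn fun s hs => ?_
  have hsT : s < T := hs.trans t.2
  simp only [rewardSeq, hs, hsT, dif_pos, History.take]
  rfl

theorem isSwitchPolicy_elimPolicy (hn : ∀ l, 0 < n l) (hr : ∀ l, 0 ≤ r l) {N T : ℕ}
    (hN : T ≤ n N) : IsSwitchPolicy (N * (k - 1) + 1) T (elimPolicy k n r) := by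
  intro D
  filter_upwards [ae_eq_elimArm hn D T] with h hh
  rw [numSwitches_eq_switches h (fun t => elimArm k n r t (rewardSeq h)) fun t => (hh t).symm]
  refine (followsSchedule_elimArm hr _).switches_le hn ?_
  have := hn N
  omega

end Elimination

/-! ### Regret of the elimination policy. -/

section UpperBound

variable [NeZero k] {n : ℕ → ℕ} {r : ℕ → ℝ} {D : Environment k} {T : ℕ} {h : History k T}

/-- An active arm is played throughout its own slot, so the deviation over this window is that of
its own rewards. -/
theorem estimate_eq_mean_add (hn : ∀ l, 0 < n l)
    (hh : ∀ t : Fin T, (h t).1 = elimArm k n r t (rewardSeq h)) {l : ℕ}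
    (hl : epochStart k n (l + 1) ≤ T) {a : Fin k} (ha : a ∈ active k n r l (rewardSeq h)) :
    estimate n l a (rewardSeq h) = D.mean a + deviation D (window n l a) h / n l := by
  have h1 : deviation D (window n l a) h =
      ∑ t ∈ window n l a, (rewardSeq h t - D.mean a) := by
    have h2 : deviation D (window n l a) h = ∑ t : Fin T,
        (fun t : ℕ => if t ∈ window n l a then rewardSeq h t - D.mean a else 0) t := by
      refine Finset.sum_congr rfl fun t _ => ?_
      by_cases ht : (t : ℕ) ∈ window n l a
      · obtain ⟨he, htar⟩ := epoch_target_of_mem_window hn ht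
        have harm : (h t).1 = a := by
          rw [hh t, elimArm, he, htar]
          exact play_of_mem ha
        simp [ht, harm, rewardSeq]
      · simp [ht]
    rw [h2, Fin.sum_univ_eq_sum_range
      (fun t : ℕ => if t ∈ window n l a then rewardSeq h t - D.mean a else 0) T,
      Finset.sum_ite_mem]
    congr 1
    refine Finset.inter_eq_right.2 fun t ht => ?_
    exact Finset.mem_range.2 ((lt_of_mem_window ht).trans_le hl)
  have hnl : (n l : ℝ) ≠ 0 := by exact_mod_cast (hn l).ne'
  rw [h1, Finset.sum_sub_distrib, Finset.sum_const, card_window, nsmul_eq_mul, estimate]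
  field_simp
  ring

/-- If all confidence intervals of completed epochs are valid, the best arm is never eliminated and
the gaps of the remaining arms are controlled by the confidence radii. -/
theorem best_mem_active_and_gap_le (hn : ∀ l, 0 < n l)
    (hh : ∀ t : Fin T, (h t).1 = elimArm k n r t (rewardSeq h)) {N : ℕ}
    (hgood : ∀ l < N, ∀ a : Fin k, |deviation D (window n l a) h| ≤ n l * r l)
    {b : Fin k} (hb : ∀ a, D.mean a ≤ D.mean b) (l : ℕ) (hlN : l ≤ N)
    (hlT : epochStart k n l ≤ T) :
    b ∈ active k n r l (rewardSeq h) ∧ ∀ m < l, l = m + 1 →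
      ∀ a ∈ active k n r l (rewardSeq h), D.mean b - D.mean a ≤ 4 * r m := by
  have hk : 0 < k := Nat.pos_of_ne_zero (NeZero.ne k)
  induction l with
  | zero => exact ⟨Finset.mem_univ _, fun m hm => absurd hm (Nat.not_lt_zero m)⟩
  | succ l ih =>
    have hmono := epochStart_strictMono hk hn (Nat.lt_succ_self l)
    have hbl := (ih (by omega) (hmono.le.trans hlT)).1
    have hest : ∀ a ∈ active k n r l (rewardSeq h),
        |estimate n l a (rewardSeq h) - D.mean a| ≤ r l := by
      intro a ha
      rw [estimate_eq_mean_add (D := D) hn hh hlT ha, add_sub_cancel_left, abs_div, Nat.abs_cast,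
        div_le_iff₀ (by exact_mod_cast hn l), mul_comm]
      exact hgood l (by omega) a
    have hest' := fun a ha => abs_le.1 (hest a ha)
    refine ⟨mem_active_succ.2 ⟨hbl, fun a ha => ?_⟩, fun m _ hml a ha => ?_⟩
    · linarith [hest' a ha, hest' b hbl, hb a]
    · obtain rfl : l = m := by omega
      rw [mem_active_succ] at ha
      linarith [hest' a ha.1, hest' b hbl, ha.2 b hbl]

theorem card_filter_epoch_le (hn : ∀ l, 0 < n l) (T l : ℕ) :
    ((Finset.range T).filter fun t => epoch k n t = l).card ≤ k * n l := by
  have hk : 0 < k := Nat.pos_of_ne_zero (NeZero.ne k)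
  have hsub : ((Finset.range T).filter fun t => epoch k n t = l) ⊆
      Finset.Ico (epochStart k n l) (epochStart k n (l + 1)) := by
    intro t ht
    obtain ⟨-, rfl⟩ := Finset.mem_filter.1 ht
    exact Finset.mem_Ico.2 ⟨epochStart_epoch_le t, lt_epochStart_epoch_succ hk hn t⟩
  have := Finset.card_le_card hsub
  rw [Nat.card_Ico, epochStart_succ] at this
  omega

theorem exists_mean_eq_bestMean (D : Environment k) :
    ∃ b, D.mean b = D.bestMean ∧ ∀ a, D.mean a ≤ D.mean b := by
  obtain ⟨b, hb⟩ := exists_eq_ciSup_of_finite (f := D.mean)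
  exact ⟨b, hb, fun a => (D.mean_le_bestMean a).trans hb.ge⟩

theorem sum_gap_le (hn : ∀ l, 0 < n l) (hr : ∀ l, 0 ≤ r l)
    (hh : ∀ t : Fin T, (h t).1 = elimArm k n r t (rewardSeq h)) {N : ℕ} (hN : T ≤ n N)
    (hgood : ∀ l < N, ∀ a : Fin k, |deviation D (window n l a) h| ≤ n l * r l) :
    ∑ t : Fin T, (D.bestMean - D.mean (h t).1) ≤
      k * (n 0 + ∑ l ∈ Finset.range N, 4 * r l * n (l + 1)) := by
  have hk : 0 < k := Nat.pos_of_ne_zero (NeZero.ne k)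
  obtain ⟨b, hbest, hb⟩ := exists_mean_eq_bestMean D
  -- The bound on the gap of an arm played in epoch `l`: the trivial bound `1` in epoch `0`,
  -- afterwards the one ensured by the preceding epoch.
  set g : ℕ → ℝ := fun l => Nat.casesOn l 1 fun m => 4 * r m with hg
  have hg0 : ∀ l, 0 ≤ g l := by
    rintro (_ | m)
    · exact zero_le_one
    · exact mul_nonneg (by norm_num) (hr m)
  have hep : ∀ t < T, epoch k n t ≤ N := fun t ht => (epoch_le_of_lt hk hn (ht.trans_le hN)).1
  have h1 : ∀ t : Fin T, D.bestMean - D.mean (h t).1 ≤ (fun t : ℕ => g (epoch k n t)) t := by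
    intro t
    rw [← hbest]
    have hmem : (h t).1 ∈ active k n r (epoch k n t) (rewardSeq h) := by
      rw [hh t]
      exact play_mem (active_nonempty hr _ _) _
    have h2 := (best_mem_active_and_gap_le hn hh hgood hb (epoch k n t) (hep t t.2)
      ((epochStart_epoch_le _).trans t.2.le)).2
    simp only
    generalize epoch k n t = e at h2 hmem
    rcases e with _ | m
    · exact (le_abs_self _).trans (D.gap_le_one _ _)
    · exact h2 m (Nat.lt_succ_self m) rfl _ hmem
  calc ∑ t : Fin T, (D.bestMean - D.mean (h t).1)
      ≤ ∑ t : Fin T, (fun t : ℕ => g (epoch k n t)) t := Finset.sum_le_sum fun t _ => h1 t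
    _ = ∑ t ∈ Finset.range T, g (epoch k n t) :=
        Fin.sum_univ_eq_sum_range (fun t => g (epoch k n t)) T
    _ = ∑ l ∈ Finset.range (N + 1), ∑ t ∈ (Finset.range T).filter (fun t => epoch k n t = l),
          g (epoch k n t) := by
        refine (Finset.sum_fiberwise_of_maps_to (fun t ht => ?_) _).symm
        rw [Finset.mem_range] at ht ⊢
        exact Nat.lt_succ_of_le (hep t ht)
    _ ≤ ∑ l ∈ Finset.range (N + 1), (k * n l : ℝ) * g l := by
        refine Finset.sum_le_sum fun l _ => ?_
        rw [Finset.sum_congr rfl fun t ht => by rw [(Finset.mem_filter.1 ht).2],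
          Finset.sum_const, nsmul_eq_mul]
        refine mul_le_mul_of_nonneg_right ?_ (hg0 l)
        exact_mod_cast card_filter_epoch_le hn T l
    _ = _ := by
        rw [Finset.sum_range_succ', mul_add, Finset.mul_sum, add_comm]
        congr 1
        · simp [hg]
        · refine Finset.sum_congr rfl fun l _ => ?_
          simp only [hg]
          ring

theorem integral_le_add_mul_measureReal {Ω : Type*} [MeasurableSpace Ω] {μ : Measure Ω}
    [IsProbabilityMeasure μ] {f : Ω → ℝ} (hf : Integrable f μ) {B M : ℝ} {U : Set Ω}
    (hU : MeasurableSet U) (hB : ∀ᵐ w ∂μ, w ∉ U → f w ≤ B) (hB0 : 0 ≤ B)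
    (hM : ∀ w, f w ≤ M) : ∫ w, f w ∂μ ≤ B + M * μ.real U := by
  have h1 : ∫ w, (B + U.indicator (fun _ => M) w) ∂μ = B + M * μ.real U := by
    rw [integral_add (integrable_const _) ((integrable_const _).indicator hU),
      integral_indicator_const _ hU, smul_eq_mul, mul_comm]
    simp
  rw [← h1]
  refine integral_mono_ae hf ((integrable_const _).add ((integrable_const _).indicator hU)) ?_
  filter_upwards [hB] with w hw
  by_cases hwU : w ∈ U
  · simp only [hwU, Set.indicator_of_mem]
    linarith [hM w]
  · simpa [hwU] using hw hwU

/-- Outside the union `U` of the failures of the confidence intervals the gaps are controlled; on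
`U` the regret is at most `T`, because gaps are at most `1`. -/
theorem envRegret_elimPolicy_le (hn : ∀ l, 0 < n l) (hr : ∀ l, 0 ≤ r l) {N : ℕ} (hN : T ≤ n N)
    (D : Environment k) :
    envRegret (elimPolicy k n r) T D ≤
      k * (n 0 + ∑ l ∈ Finset.range N, 4 * r l * n (l + 1)) +
        T * ∑ l ∈ Finset.range N, k * (2 * Real.exp (-(n l * r l ^ 2) / 2)) := by
  obtain ⟨b, hbest, -⟩ := exists_mean_eq_bestMean D
  set μ := law (elimPolicy k n r) D T
  set V : ℕ → Fin k → Set (History k T) := fun l a =>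
    {h | n l * r l < |deviation D (window n l a) h|} with hV
  have hVm : ∀ l a, MeasurableSet (V l a) := fun l a =>
    measurableSet_lt measurable_const (measurable_deviation D _).abs
  set U : Set (History k T) := ⋃ l ∈ Finset.range N, ⋃ a ∈ (Finset.univ : Finset (Fin k)), V l a
    with hU
  have hUm : MeasurableSet U := Finset.measurableSet_biUnion _ fun l _ =>
    Finset.measurableSet_biUnion _ fun a _ => hVm l a
  have hUle : μ.real U ≤ ∑ l ∈ Finset.range N, k * (2 * Real.exp (-(n l * r l ^ 2) / 2)) := by
    refine (measureReal_biUnion_finset_le _ _).trans (Finset.sum_le_sum fun l _ => ?_)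
    refine (measureReal_biUnion_finset_le _ _).trans ?_
    have h1 : ∀ a ∈ (Finset.univ : Finset (Fin k)),
        μ.real (V l a) ≤ 2 * Real.exp (-(n l * r l ^ 2) / 2) := by
      intro a _
      have := measureReal_lt_abs_deviation_le (elimPolicy k n r) D (window n l a) T (hr l)
      rwa [card_window] at this
    refine (Finset.sum_le_sum h1).trans (le_of_eq ?_)
    rw [Finset.sum_const, Finset.card_univ, Fintype.card_fin, nsmul_eq_mul]
  have hB0 : 0 ≤ (k : ℝ) * (n 0 + ∑ l ∈ Finset.range N, 4 * r l * n (l + 1)) := by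
    refine mul_nonneg (Nat.cast_nonneg _) (add_nonneg (Nat.cast_nonneg _) ?_)
    exact Finset.sum_nonneg fun l _ =>
      mul_nonneg (mul_nonneg (by norm_num) (hr l)) (Nat.cast_nonneg _)
  rw [envRegret_eq_integral_gap]
  refine (integral_le_add_mul_measureReal (integrable_gap _ D T) hUm ?_ hB0 (M := T) ?_).trans
    (add_le_add_right (mul_le_mul_of_nonneg_left hUle (Nat.cast_nonneg _)) _)
  · filter_upwards [ae_eq_elimArm hn D T] with h hh hhU
    refine sum_gap_le hn hr hh hN fun l hl a => ?_
    by_contra hcon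
    rw [not_le] at hcon
    exact hhU (Set.mem_biUnion (Finset.mem_range.2 hl) (Set.mem_biUnion (Finset.mem_univ a) hcon))
  · intro h
    have h1 : ∀ t ∈ (Finset.univ : Finset (Fin T)), D.bestMean - D.mean (h t).1 ≤ 1 := by
      intro t _
      rw [← hbest]
      exact (le_abs_self _).trans (D.gap_le_one _ _)
    simpa using Finset.sum_le_card_nsmul _ _ _ h1

end UpperBound

/-! ### Choice of the slot lengths, and the two sufficiency statements. -/

section UpperRate

/-- The length of the slots of epoch `l`. -/
noncomputable def slotLength (N T l : ℕ) : ℕ :=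
  ⌈((T : ℝ) ^ (1 / (2 - (1 / 2 : ℝ) ^ N))) ^ (2 - (1 / 2 : ℝ) ^ l)⌉₊ + 1

/-- The confidence radius of epoch `l`. -/
noncomputable def radius (N T l : ℕ) : ℝ := Real.sqrt (2 * Real.log T / slotLength N T l)

/-- The summand `1` covers `T = 0`, so that the switch bound holds for every horizon. -/
theorem slotLength_pos (N T l : ℕ) : 0 < slotLength N T l := Nat.succ_pos _

theorem radius_nonneg (N T l : ℕ) : 0 ≤ radius N T l := Real.sqrt_nonneg _

theorem half_pow_le_one (l : ℕ) : (1 / 2 : ℝ) ^ l ≤ 1 :=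
  pow_le_one₀ (by norm_num) (by norm_num)

theorem le_slotLength (N T : ℕ) : T ≤ slotLength N T N := by
  have h1 : ((T : ℝ) ^ (1 / (2 - (1 / 2 : ℝ) ^ N))) ^ (2 - (1 / 2 : ℝ) ^ N) = T := by
    rw [← Real.rpow_mul (Nat.cast_nonneg T), one_div_mul_cancel, Real.rpow_one]
    linarith [half_pow_le_one N]
  rw [slotLength, h1, Nat.ceil_natCast]
  exact Nat.le_succ T

/-- The policy with `N` exploration epochs for the horizon `T`. -/
noncomputable def batchPolicy (k : ℕ) [NeZero k] (N T : ℕ) : Policy k :=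
  elimPolicy k (slotLength N T) (radius N T)

theorem isSwitchPolicy_batchPolicy [NeZero k] (N T : ℕ) :
    IsSwitchPolicy (N * (k - 1) + 1) T (batchPolicy k N T) :=
  isSwitchPolicy_elimPolicy (slotLength_pos N T) (radius_nonneg N T) (le_slotLength N T)

theorem envRegret_batchPolicy_le [NeZero k] {N T : ℕ} (hN : 1 ≤ N) (hT : 3 ≤ T)
    (D : Environment k) :
    envRegret (batchPolicy k N T) T D ≤
      29 * k * N * Real.log T * (T : ℝ) ^ (1 / (2 - (1 / 2 : ℝ) ^ N)) := by
  have hT3 : (3 : ℝ) ≤ T := by exact_mod_cast hT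
  have hlog : 1 ≤ Real.log T := by
    rw [Real.le_log_iff_exp_le (by linarith)]
    linarith [Real.exp_one_lt_d9]
  have hN1 : (1 : ℝ) ≤ N := by exact_mod_cast hN
  have hk1 : (0 : ℝ) ≤ k := Nat.cast_nonneg k
  set R : ℝ := (T : ℝ) ^ (1 / (2 - (1 / 2 : ℝ) ^ N)) with hR
  have hR1 : 1 ≤ R :=
    Real.one_le_rpow (by linarith) (one_div_nonneg.2 (by linarith [half_pow_le_one N]))
  have hR0 : 0 < R := by linarith
  -- `s l` is the square root of the slot length up to rounding; `s (l + 1) ^ 2 = R * s l` makes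
  -- each epoch cost about `R`.
  set s : ℕ → ℝ := fun l => R ^ (1 - (1 / 2 : ℝ) ^ (l + 1)) with hs
  have hs1 : ∀ l, 1 ≤ s l := fun l =>
    Real.one_le_rpow hR1 (by linarith [half_pow_le_one (l + 1)])
  have hpow : ∀ l, R ^ (2 - (1 / 2 : ℝ) ^ l) = s l ^ 2 := by
    intro l
    simp only [hs]
    rw [← Real.rpow_mul_natCast hR0.le]
    congr 1
    push_cast
    ring
  have hsucc : ∀ l, s (l + 1) ^ 2 = R * s l := by
    intro l
    rw [← hpow, hs]
    nth_rewrite 2 [← Real.rpow_one R]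
    rw [← Real.rpow_add hR0]
    congr 1
    ring
  have hlow : ∀ l, s l ^ 2 ≤ slotLength N T l := by
    intro l
    have := Nat.le_ceil (R ^ (2 - (1 / 2 : ℝ) ^ l))
    rw [slotLength, ← hpow]
    push_cast
    linarith
  have hup : ∀ l, (slotLength N T l : ℝ) ≤ 3 * s l ^ 2 := by
    intro l
    have := Nat.ceil_lt_add_one (show 0 ≤ R ^ (2 - (1 / 2 : ℝ) ^ l) by positivity)
    rw [slotLength]
    push_cast
    rw [← hR]
    have h1 : 1 ≤ s l ^ 2 := one_le_pow₀ (hs1 l)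
    rw [← hpow] at h1 ⊢
    linarith
  have hrad : ∀ l, radius N T l * slotLength N T (l + 1) ≤ 6 * R * Real.log T := by
    intro l
    have hsl : 0 < s l := by linarith [hs1 l]
    have h1 : radius N T l ≤ 2 * Real.log T / s l := by
      rw [radius, Real.sqrt_le_left (by positivity), div_pow]
      refine div_le_div₀ (by positivity) ?_ (by positivity) (hlow l)
      nlinarith
    have h2 : (slotLength N T (l + 1) : ℝ) ≤ 3 * (R * s l) := by
      rw [← hsucc]
      exact hup (l + 1)
    calc _ ≤ 2 * Real.log T / s l * (3 * (R * s l)) :=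
        mul_le_mul h1 h2 (Nat.cast_nonneg _) (by positivity)
      _ = _ := by
        field_simp
        ring
  -- The radius is tuned so that each failure has probability at most `2 / T`, which offsets the
  -- loss `T`.
  have hexp : ∀ l, Real.exp (-(slotLength N T l * radius N T l ^ 2) / 2) = (T : ℝ)⁻¹ := by
    intro l
    have hn0 : (slotLength N T l : ℝ) ≠ 0 := by exact_mod_cast (slotLength_pos N T l).ne'
    rw [radius, Real.sq_sqrt (by positivity), mul_div_cancel₀ _ hn0, neg_div,
      mul_div_cancel_left₀ _ two_ne_zero, Real.exp_neg, Real.exp_log (by linarith)]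
  have hzero : (slotLength N T 0 : ℝ) ≤ 3 * R := by
    have := hup 0
    rw [← hpow] at this
    norm_num at this
    exact this
  refine (envRegret_elimPolicy_le (slotLength_pos N T) (radius_nonneg N T) (le_slotLength N T)
    D).trans ?_
  have hsum : ∑ l ∈ Finset.range N, 4 * radius N T l * slotLength N T (l + 1) ≤
      N * (24 * R * Real.log T) := by
    have h1 : ∀ l ∈ Finset.range N,
        4 * radius N T l * slotLength N T (l + 1) ≤ 24 * R * Real.log T := fun l _ => by
      linarith [hrad l]
    simpa using Finset.sum_le_card_nsmul _ _ _ h1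
  have hbad : (T : ℝ) * ∑ l ∈ Finset.range N,
      k * (2 * Real.exp (-(slotLength N T l * radius N T l ^ 2) / 2)) = 2 * k * N := by
    simp only [hexp, Finset.sum_const, Finset.card_range, nsmul_eq_mul]
    field_simp
  rw [hbad]
  have hRL : R ≤ R * Real.log T := le_mul_of_one_le_right hR0.le hlog
  have hRLN : R * Real.log T ≤ N * (R * Real.log T) :=
    le_mul_of_one_le_left (by positivity) hN1
  have h2 : 2 * (N : ℝ) ≤ 2 * (N * (R * Real.log T)) := by
    have : (N : ℝ) * 1 ≤ N * (R * Real.log T) :=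
      mul_le_mul_of_nonneg_left (hR1.trans hRL) (by linarith)
    linarith
  calc _ ≤ k * (3 * R + N * (24 * R * Real.log T)) + k * (2 * N) := by
        have := mul_le_mul_of_nonneg_left (add_le_add hzero hsum) hk1
        linarith
    _ ≤ k * (29 * (N * (R * Real.log T))) := by
        rw [← mul_add]
        refine mul_le_mul_of_nonneg_left ?_ hk1
        linarith
    _ = _ := by ring

theorem budget_sufficient [NeZero k] {N : ℕ} (hN : 1 ≤ N) :
    ∃ π : ℕ → Policy k, (∀ T : ℕ, IsSwitchPolicy (N * (k - 1) + 1) T (π T)) ∧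
      IsSoftO (fun T => regret (π T) T)
        (fun T => (T : ℝ) ^ ((1 : ℝ) / (2 - (2 : ℝ) ^ (-(N : ℝ))))) := by
  refine ⟨fun T => batchPolicy k N T, fun T => isSwitchPolicy_batchPolicy N T, 29 * k * N, 1, ?_⟩
  filter_upwards [eventually_ge_atTop 3] with T hT
  refine iSup_le fun D => EReal.coe_le_coe_iff.2 ?_
  rw [two_rpow_neg_natCast, pow_one]
  exact envRegret_batchPolicy_le hN hT D

/-- The number of exploration epochs that suffices for regret of order `√T`. -/
noncomputable def numEpochs (T : ℕ) : ℕ := ⌈2 * Real.log (Real.log T)⌉₊ + 1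

theorem rpow_numEpochs_le {T : ℕ} (hT : 1 ≤ Real.log (Real.log T)) :
    (T : ℝ) ^ (1 / (2 - (1 / 2 : ℝ) ^ numEpochs T)) ≤ 2 * Real.sqrt T := by
  have hL1 : 1 < Real.log T := by
    by_contra hcon
    rw [not_lt] at hcon
    have := Real.log_nonpos (Real.log_natCast_nonneg T) hcon
    linarith
  have hT0 : (0 : ℝ) < T := by
    rcases Nat.eq_zero_or_pos T with h | h
    · rw [h, Nat.cast_zero, Real.log_zero] at hL1
      linarith
    · exact_mod_cast h
  have hTexp : 1 ≤ (T : ℝ) := by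
    rw [← Real.exp_log hT0]
    exact Real.one_le_exp (by linarith)
  set x : ℝ := (1 / 2 : ℝ) ^ numEpochs T with hx
  have hx0 : 0 < x := by positivity
  have hx1 : x ≤ 1 := half_pow_le_one _
  -- The factor `2` in `numEpochs` suffices because `2 * log 2 > 1`. The excess of the exponent over
  -- `1 / 2` is then at most `1 / (2 * log T)`, a constant factor.
  have hxL : x * Real.log T ≤ 1 := by
    have e1 : x = Real.exp (-(numEpochs T * Real.log 2)) := by
      rw [Real.exp_neg, Real.exp_nat_mul, Real.exp_log (by norm_num), hx, one_div, inv_pow]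
    have e2 : Real.log T = Real.exp (Real.log (Real.log T)) :=
      (Real.exp_log (by linarith)).symm
    rw [e1, e2, ← Real.exp_add, Real.exp_le_one_iff]
    have h1 : 2 * Real.log (Real.log T) ≤ numEpochs T := by
      rw [numEpochs]
      push_cast
      linarith [Nat.le_ceil (2 * Real.log (Real.log T))]
    have h2 := Real.log_two_gt_d9
    nlinarith
  have hexp : 1 / (2 - x) ≤ 1 / 2 + x / 2 := by
    rw [div_le_iff₀ (by linarith)]
    nlinarith
  calc (T : ℝ) ^ (1 / (2 - x)) ≤ (T : ℝ) ^ (1 / 2 + x / 2) :=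
      Real.rpow_le_rpow_of_exponent_le hTexp hexp
    _ = Real.sqrt T * Real.exp (x * Real.log T / 2) := by
      rw [Real.rpow_add hT0, ← Real.sqrt_eq_rpow, Real.rpow_def_of_pos hT0]
      congr 2
      ring
    _ ≤ Real.sqrt T * 2 := by
      refine mul_le_mul_of_nonneg_left ?_ (Real.sqrt_nonneg _)
      have h1 : Real.exp (x * Real.log T / 2) ≤ Real.exp (1 / 2) :=
        Real.exp_le_exp.2 (by linarith)
      have h2 : Real.exp (1 / 2) ^ 2 = Real.exp 1 := by
        rw [← Real.exp_nat_mul]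
        norm_num
      have h3 := Real.exp_one_lt_d9
      have h4 := Real.exp_pos (1 / 2)
      nlinarith
    _ = _ := mul_comm _ _

theorem tendsto_loglog :
    Tendsto (fun T : ℕ => Real.log (Real.log T)) atTop atTop :=
  Real.tendsto_log_atTop.comp (Real.tendsto_log_atTop.comp tendsto_natCast_atTop_atTop)

theorem numEpochs_le {T : ℕ} (hT : 1 ≤ Real.log (Real.log T)) :
    (numEpochs T : ℝ) ≤ 4 * Real.log (Real.log T) := by
  have := Nat.ceil_lt_add_one (show 0 ≤ 2 * Real.log (Real.log T) by linarith)
  rw [numEpochs]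
  push_cast
  linarith

theorem isTheta_numEpochs_mul (hk : 2 ≤ k) :
    Asymptotics.IsTheta atTop (fun T : ℕ => ((numEpochs T * (k - 1) + 1 : ℕ) : ℝ))
      (fun T : ℕ => Real.log (Real.log T)) := by
  constructor
  · refine Asymptotics.IsBigO.of_bound (4 * k) ?_
    filter_upwards [tendsto_loglog.eventually_ge_atTop 1] with T hT
    rw [Real.norm_natCast, Real.norm_of_nonneg (by linarith)]
    have h1 : numEpochs T * (k - 1) + 1 ≤ numEpochs T * k := by
      have h2 : numEpochs T * k = numEpochs T * (k - 1) + numEpochs T := by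
        rw [← Nat.mul_succ, Nat.succ_eq_add_one, Nat.sub_add_cancel (by omega)]
      have h3 : 1 ≤ numEpochs T := Nat.succ_pos _
      omega
    calc ((numEpochs T * (k - 1) + 1 : ℕ) : ℝ) ≤ numEpochs T * k := by exact_mod_cast h1
      _ ≤ 4 * Real.log (Real.log T) * k :=
        mul_le_mul_of_nonneg_right (numEpochs_le hT) (Nat.cast_nonneg k)
      _ = _ := by ring
  · refine Asymptotics.IsBigO.of_bound 1 ?_
    filter_upwards [tendsto_loglog.eventually_ge_atTop 1] with T hT
    rw [Real.norm_natCast, Real.norm_of_nonneg (by linarith), one_mul]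
    have h1 : numEpochs T ≤ numEpochs T * (k - 1) + 1 :=
      (Nat.le_mul_of_pos_right _ (by omega)).trans (Nat.le_succ _)
    have h2 : (numEpochs T : ℝ) ≤ ((numEpochs T * (k - 1) + 1 : ℕ) : ℝ) := by
      exact_mod_cast h1
    refine le_trans ?_ h2
    rw [numEpochs]
    push_cast
    linarith [Nat.le_ceil (2 * Real.log (Real.log T))]

theorem loglog_sufficient [NeZero k] :
    ∃ π : ℕ → Policy k,
      (∀ T : ℕ, IsSwitchPolicy (numEpochs T * (k - 1) + 1) T (π T)) ∧
        IsSoftO (fun T => regret (π T) T) (fun T => Real.sqrt T) := by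
  refine ⟨fun T => batchPolicy k (numEpochs T) T,
    fun T => isSwitchPolicy_batchPolicy (numEpochs T) T, 29 * k * 4 * 2, 2, ?_⟩
  filter_upwards [eventually_ge_atTop 3, tendsto_loglog.eventually_ge_atTop 1] with T hT hT1
  refine iSup_le fun D => EReal.coe_le_coe_iff.2 ?_
  have hlog : 0 < Real.log T := Real.log_pos (by exact_mod_cast (show 1 < T by omega))
  have h1 : (numEpochs T : ℝ) ≤ 4 * Real.log T := by
    have := Real.log_le_sub_one_of_pos hlog
    linarith [numEpochs_le hT1]
  calc _ ≤ 29 * k * numEpochs T * Real.log T *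
        (T : ℝ) ^ (1 / (2 - (1 / 2 : ℝ) ^ numEpochs T)) :=
        envRegret_batchPolicy_le (Nat.succ_pos _) hT D
    _ ≤ 29 * k * (4 * Real.log T) * Real.log T * (2 * Real.sqrt T) := by
        gcongr
        exact rpow_numEpochs_le hT1
    _ = _ := by ring

end UpperRate

end Bandit

theorem corollary2 (k : ℕ) (hk : 2 ≤ k) :
    -- first part: `N (k - 1) + 1` switches and regret of order `T ^ (1 / (2 - 2 ^ (-N)))`
    (∀ N : ℕ, 1 ≤ N →
      -- sufficiency
      (∃ π : ℕ → Bandit.Policy k,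
        (∀ T : ℕ, Bandit.IsSwitchPolicy (N * (k - 1) + 1) T (π T)) ∧
        Bandit.IsSoftO (fun T => Bandit.regret (π T) T)
          (fun T => (T : ℝ) ^ ((1 : ℝ) / (2 - (2 : ℝ) ^ (-(N : ℝ)))))) ∧
      -- necessity
      (∀ π : ℕ → Bandit.Policy k,
        Bandit.IsSoftO (fun T => Bandit.regret (π T) T)
          (fun T => (T : ℝ) ^ ((1 : ℝ) / (2 - (2 : ℝ) ^ (-(N : ℝ))))) →
        ∀ᶠ T : ℕ in atTop, ∀ S : ℕ,
          Bandit.IsSwitchPolicy S T (π T) → N * (k - 1) + 1 ≤ S)) ∧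
    -- second part: order `log log T` switches and regret of order `√T`
    -- sufficiency
    (∃ S : ℕ → ℕ,
      Asymptotics.IsTheta atTop (fun T : ℕ => (S T : ℝ))
        (fun T : ℕ => Real.log (Real.log T)) ∧
      ∃ π : ℕ → Bandit.Policy k,
        (∀ T : ℕ, Bandit.IsSwitchPolicy (S T) T (π T)) ∧
        Bandit.IsSoftO (fun T => Bandit.regret (π T) T) (fun T => Real.sqrt T)) ∧
    -- necessity
    (∃ c : ℝ, 0 < c ∧
      ∀ π : ℕ → Bandit.Policy k,
        Bandit.IsSoftO (fun T => Bandit.regret (π T) T) (fun T => Real.sqrt T) →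
        ∀ᶠ T : ℕ in atTop, ∀ S : ℕ,
          Bandit.IsSwitchPolicy S T (π T) → c * Real.log (Real.log T) ≤ S) := by
  have : NeZero k := ⟨by omega⟩
  exact ⟨fun N hN => ⟨Bandit.budget_sufficient hN, fun π hπ => Bandit.budget_necessary hk hN π hπ⟩,
    ⟨fun T => Bandit.numEpochs T * (k - 1) + 1, Bandit.isTheta_numEpochs_mul hk,
      Bandit.loglog_sufficient⟩,
    1 / 2, by norm_num, fun π hπ => Bandit.loglog_necessary hk π hπ⟩
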